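/- **Theorem 8 (liveness of the HashGraph protocol).** *Setting.* There are $n \ge 2$ parties, of which an adversary statically corrupts at most $t$, where $t < n/3$; the others are honest. Parties exchange *events*. An event carries a creator, a list of transactions (from a countable set), a timestamp and a signature, and is either a genesis event (no parents) or has a *self-parent*, an event of the same creator, and an *other-parent*. Parents are referenced by collision-free hashes. Signatures of honest parties are unforgeable; corrupted parties may create any other events, with any signatures. An event is regarded as an ancestor of itself; an ancestor is a self-ancestor if it is reached through self-parents only. A *fork* is a pair of events of one creator neither of which is a self-ancestor of the other. Event $x$ *sees* $y$ if $y$ is an ancestor of $x$ and no two ancestors of $x$ form a fork of $y$'s creator; $x$ *strongly sees* $y$ if $x$ sees events of more than $2n/3$ distinct creators that each see $y$. *Protocol.* Each honest party starts with a hashgraph that consists of its own genesis event, which carries no transactions. Whenever it receives a sync whose latest event $y$ is new to it, it adds $y$ and the ancestors of $y$ to its hashgraph (unless they are badly formatted or forged) and creates one new event, with its own previous event as self-parent, $y$ as other-parent, and containing all transactions in its buffer. - *Rounds.* Genesis events have round 1. Any other event $x$ has round $r+1$ if it strongly sees round-$r$ witnesses of more than $2n/3$ distinct parties, and round $r$ otherwise,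 where $r$ is the largest round of its parents. A *witness* is an event without self-parent or with a self-parent of an earlier round. - *Fame.* Fix an integer $c > 1$. In the election on a round-$r$ witness $x$, a round-$(r+1)$ witness votes "yes" iff it sees $x$. For $d \ge 2$, a round-$(r+d)$ witness $y$ considers the round-$(r+d-1)$ witnesses that it strongly sees; let $v$ be their majority vote ("yes" for a tie). If $c \nmid d$ (normal round), $y$ votes $v$, and if more than $2n/3$ of them vote $v$, then $y$ decides that the fame of $x$ is $v$. If $c \mid d$ (coin round), $y$ votes $v$ if more than $2n/3$ of them vote $v$, and otherwise votes the middle bit of its own signature. In a hashgraph, the fame of $x$ is decided if some witness in it decides it, and $x$ is famous if the earliest round with a deciding witness decides "yes". A famous witness is *unique* if it is the only famous witness of its creator and its round. - *Log.* A party's hashgraph assigns to an event $x$ in it, as *roundReceived*, the least round $r \ge 1$ such that the fame of all witnesses in it of rounds $\le r$ is decided and all its unique famous witnesses of round $r$ see $x$. As soon as $x$ has a roundReceived, $x$, with its transactions, is output to the party's write-once log. *Network and randomness.* The execution proceeds in steps; the adversary schedules all deliveries, clock readings and transaction inputs, adaptively on the basis of the whole past, but almost surely every event held by an honest party is eventually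 received by every honest party. The middle bit of the signature of each newly created non-genesis event of an honest party is a fair coin, independent of everything that happened before the event is created. *Claim.* The protocol is live: 1. Almost surely, for every witness in an honest party's hashgraph, that party's hashgraph eventually decides its fame. Moreover, for every honest party and every time $k$, the probability that each witness $x$ in its hashgraph at time $k$ eventually has its fame decided, in this party's hashgraph, by a witness of round at most $x.\mathrm{round} + mc$ (within $m$ coin rounds) tends to $1$ as $m \to \infty$. 2. Almost surely, for every event $x$ created by an honest party there is a round $r$ such that every honest party eventually has a witness of round $r$ and, at that same time, has decided the fame of all witnesses in its hashgraph of rounds $\le r$, and such that at all times all unique famous witnesses of round $r$ in the hashgraphs of honest parties see $x$ (in particular, $x$ is an ancestor of all of them). 3. Almost surely, every event created by an honest party is eventually output to the log of every honest party. 4. Almost surely, every transaction placed in the buffer of an honest party is eventually in the log of every honest party. -/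

import Mathlib

open MeasureTheory ProbabilityTheory Filter Topology

namespace Hashgraph

/-- A signature is a bit string of odd length, so that it has a middle bit. -/
abbrev Signature (ℓ : ℕ) : Type := Fin (2 * ℓ + 1) → Bool

/-- The middle bit of a signature; `true` is a "yes" coin. -/
def middleBit {ℓ : ℕ} (s : Signature ℓ) : Bool := s ⟨ℓ, by omega⟩

/-- The contents of an event, apart from its creator and its parents. -/
structure EventData (ℓ : ℕ) (Tx : Type*) where
  transactions : List Tx
  timestamp : ℕ
  signature : Signature ℓ

/-- Events of a protocol with `n` parties. A genesis event has no parents; any other event has a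
self-parent and an other-parent. Parent pointers are hashes under a collision-free hash function,
so an event determines its parents, and with them all its ancestors. -/
inductive Event (n ℓ : ℕ) (Tx : Type*) where
  | genesis (creator : Fin n) (data : EventData ℓ Tx) : Event n ℓ Tx
  | node (creator : Fin n) (selfParent otherParent : Event n ℓ Tx) (data : EventData ℓ Tx) :
      Event n ℓ Tx

namespace Event

variable {n ℓ : ℕ} {Tx : Type*}

def creator : Event n ℓ Tx → Fin n
  | genesis i _ => i
  | node i _ _ _ => i

def data : Event n ℓ Tx → EventData ℓ Tx
  | genesis _ d => d
  | node _ _ _ d => d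

/-- The format check: a self-parent has the same creator as its child. -/
def WellFormatted : Event n ℓ Tx → Prop
  | genesis _ _ => True
  | node i p _ _ => p.creator = i

open Classical in
/-- The ancestors of an event (an event is an ancestor of itself). -/
noncomputable def ancestors : Event n ℓ Tx → Finset (Event n ℓ Tx)
  | genesis i d => {genesis i d}
  | node i p q d => insert (node i p q d) (ancestors p ∪ ancestors q)

open Classical in
/-- The ancestors that are reached through self-parent pointers only. -/
noncomputable def selfAncestors : Event n ℓ Tx → Finset (Event n ℓ Tx)
  | genesis i d => {genesis i d}
  | node i p q d => insert (node i p q d) (selfAncestors p)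

/-- A fork: two events of one creator that do not lie on one chain of self-parents. -/
def IsFork (x y : Event n ℓ Tx) : Prop :=
  x.creator = y.creator ∧ x ∉ y.selfAncestors ∧ y ∉ x.selfAncestors

/-- `x` observes a fork of party `i`. -/
def ObservesFork (x : Event n ℓ Tx) (i : Fin n) : Prop :=
  ∃ z ∈ x.ancestors, ∃ z' ∈ x.ancestors, z.creator = i ∧ IsFork z z'

/-- `x` sees `y`. A hashgraph contains all ancestors of its events, so this does not depend on the
hashgraph in which it is evaluated. -/
def Sees (x y : Event n ℓ Tx) : Prop :=
  y ∈ x.ancestors ∧ ¬ x.ObservesFork y.creator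

open Classical in
/-- `x` strongly sees `y`: the events that `x` sees and that see `y` have more than `2n/3`
distinct creators. -/
def StronglySees (x y : Event n ℓ Tx) : Prop :=
  2 * n < 3 * ((x.ancestors.filter fun z => x.Sees z ∧ z.Sees y).image creator).card

theorem sizeOf_le_of_mem_ancestors {x y : Event n ℓ Tx} (h : y ∈ x.ancestors) :
    sizeOf y ≤ sizeOf x := by
  induction x with
  | genesis i d =>
    simp only [ancestors, Finset.mem_singleton] at h
    rw [h]
  | node i p q d ihp ihq =>
    simp only [ancestors, Finset.mem_insert, Finset.mem_union] at h
    rcases h with h | h | h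
    · rw [h]
    · have := ihp h
      simp only [node.sizeOf_spec]
      omega
    · have := ihq h
      simp only [node.sizeOf_spec]
      omega

open Classical in
theorem sizeOf_lt_of_mem_union {p q : Event n ℓ Tx}
    (y : { y // y ∈ p.ancestors ∪ q.ancestors }) (i : Fin n)
    (d : EventData ℓ Tx) : sizeOf y.1 < sizeOf (node i p q d) := by
  rw [node.sizeOf_spec]
  rcases Finset.mem_union.mp y.2 with h | h
  · have := sizeOf_le_of_mem_ancestors h
    omega
  · have := sizeOf_le_of_mem_ancestors h
    omega

open Classical in
/-- The procedure that divides events into rounds: the round of an event, and whether the event is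
a witness. -/
noncomputable def roundInfo : Event n ℓ Tx → ℕ × Bool
  | genesis _ _ => (1, true)
  | node i p q d =>
    let r := max (roundInfo p).1 (roundInfo q).1
    let seen := (p.ancestors ∪ q.ancestors).attach.filter fun y =>
      (roundInfo y.1).1 = r ∧ (roundInfo y.1).2 = true ∧ (node i p q d).StronglySees y.1
    let r' := if 2 * n < 3 * (seen.image fun y => y.1.creator).card then r + 1 else r
    (r', decide ((roundInfo p).1 < r'))
termination_by x => sizeOf x
decreasing_by
  all_goals first
    | exact sizeOf_lt_of_mem_union _ _ _
    | (simp only [node.sizeOf_spec]; omega)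

/-- The round of an event. -/
noncomputable def round (x : Event n ℓ Tx) : ℕ := x.roundInfo.1

/-- A witness has no self-parent or a self-parent of an earlier round. -/
def IsWitness (x : Event n ℓ Tx) : Prop := x.roundInfo.2 = true

theorem round_genesis (i : Fin n) (d : EventData ℓ Tx) : (genesis i d).round = 1 := by
  simp [round, roundInfo]

theorem isWitness_genesis (i : Fin n) (d : EventData ℓ Tx) : (genesis i d).IsWitness := by
  simp [IsWitness, roundInfo]

theorem isWitness_node (i : Fin n) (p q : Event n ℓ Tx) (d : EventData ℓ Tx) :
    (node i p q d).IsWitness ↔ p.round < (node i p q d).round := by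
  simp only [IsWitness, round]
  rw [roundInfo]
  simp

open Classical in
/-- The round of a non-genesis event, with `r` the largest round of its parents: `r + 1` if the
event strongly sees round-`r` witnesses of more than `2n/3` distinct parties, and `r` otherwise. -/
theorem round_node (i : Fin n) (p q : Event n ℓ Tx) (d : EventData ℓ Tx) :
    (node i p q d).round =
      if 2 * n < 3 * (((p.ancestors ∪ q.ancestors).filter fun y =>
          y.round = max p.round q.round ∧ y.IsWitness ∧
            (node i p q d).StronglySees y).image creator).card
      then max p.round q.round + 1 else max p.round q.round := by
  have key : (((p.ancestors ∪ q.ancestors).attach.filter fun y =>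
      (roundInfo y.1).1 = max (roundInfo p).1 (roundInfo q).1 ∧ (roundInfo y.1).2 = true ∧
        (node i p q d).StronglySees y.1).image fun y => y.1.creator) =
      ((p.ancestors ∪ q.ancestors).filter fun y =>
        y.round = max p.round q.round ∧ y.IsWitness ∧
          (node i p q d).StronglySees y).image creator := by
    ext j
    rw [Finset.mem_image, Finset.mem_image]
    constructor
    · rintro ⟨y, hy, rfl⟩
      exact ⟨y.1, Finset.mem_filter.mpr ⟨y.2, (Finset.mem_filter.mp hy).2⟩, rfl⟩
    · rintro ⟨y, hy, rfl⟩
      obtain ⟨h₁, h₂⟩ := Finset.mem_filter.mp hy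
      exact ⟨⟨y, h₁⟩, Finset.mem_filter.mpr ⟨Finset.mem_attach _ _, h₂⟩, rfl⟩
  rw [← key]
  simp only [round]
  rw [roundInfo]

open Classical in
/-- The witnesses of the preceding round that `y` strongly sees. -/
noncomputable def electors (y : Event n ℓ Tx) : Finset (Event n ℓ Tx) :=
  y.ancestors.filter fun z => z.IsWitness ∧ z.round + 1 = y.round ∧ y.StronglySees z

/-- The number of electors of `y` whose vote, as given by `f`, is `v`. -/
noncomputable def tally (f : Event n ℓ Tx → Bool) (y : Event n ℓ Tx) (v : Bool) : ℕ :=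
  (y.electors.filter fun z => f z = v).card

/-- The majority vote among the electors of `y`; a tie counts as "yes". -/
noncomputable def majority (f : Event n ℓ Tx → Bool) (y : Event n ℓ Tx) : Bool :=
  decide (tally f y false ≤ tally f y true)

/-- The vote of an event `y` in the election on the fame of `x`, where the first argument after `x`
is the number of rounds from `x` to `y`. Every `c`-th round is a coin round. -/
noncomputable def voteAt (c : ℕ) (x : Event n ℓ Tx) : ℕ → Event n ℓ Tx → Bool
  | 0, _ => false
  | 1, y => open Classical in decide (y.Sees x)
  | d + 2, y =>
    let v := majority (voteAt c x (d + 1)) y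
    if (d + 2) % c = 0 ∧ ¬ 2 * n < 3 * tally (voteAt c x (d + 1)) y v then
      middleBit y.data.signature
    else v

/-- The witness `y` decides that the fame of `x` is `v`: the election is in a normal round (not its
first one) and `y` strongly sees more than `2n/3` witnesses of the preceding round that vote `v`. -/
def Decides (c : ℕ) (x y : Event n ℓ Tx) (v : Bool) : Prop :=
  y.IsWitness ∧ x.round + 2 ≤ y.round ∧ (y.round - x.round) % c ≠ 0 ∧
    v = majority (voteAt c x (y.round - x.round - 1)) y ∧
    2 * n < 3 * tally (voteAt c x (y.round - x.round - 1)) y v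

end Event

open Event

section Local

variable {n ℓ : ℕ} {Tx : Type*}

/-- The fame of `x` has been decided in the hashgraph `H`. -/
def FameDecided (c : ℕ) (H : Finset (Event n ℓ Tx)) (x : Event n ℓ Tx) : Prop :=
  ∃ y ∈ H, ∃ v, Decides c x y v

/-- `x` is a famous witness in `H`: the first round in which some witness decides its fame decides
"yes". -/
def IsFamousWitness (c : ℕ) (H : Finset (Event n ℓ Tx)) (x : Event n ℓ Tx) : Prop :=
  x ∈ H ∧ x.IsWitness ∧
    ∃ y ∈ H, Decides c x y true ∧ ∀ y' ∈ H, ∀ v, Decides c x y' v → y.round ≤ y'.round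

/-- `x` is a unique famous witness of round `r` in `H`. -/
def IsUniqueFamousWitness (c : ℕ) (H : Finset (Event n ℓ Tx)) (r : ℕ) (x : Event n ℓ Tx) : Prop :=
  IsFamousWitness c H x ∧ x.round = r ∧
    ∀ x', IsFamousWitness c H x' → x'.round = r → x'.creator = x.creator → x' = x

/-- The fame of every witness of `H` in every round up to `r` has been decided. -/
def AllDecidedUpTo (c : ℕ) (H : Finset (Event n ℓ Tx)) (r : ℕ) : Prop :=
  ∀ y ∈ H, y.IsWitness → y.round ≤ r → FameDecided c H y

/-- `r` is the value of `roundReceived` that `H` assigns to `x` (rounds start at `1`). -/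
def IsRoundReceived (c : ℕ) (H : Finset (Event n ℓ Tx)) (x : Event n ℓ Tx) (r : ℕ) : Prop :=
  x ∈ H ∧ IsLeast {r | 1 ≤ r ∧ AllDecidedUpTo c H r ∧
    ∀ w, IsUniqueFamousWitness c H r w → w.Sees x} r

end Local

/-- What can happen in one step of an execution; the adversary chooses.
* `submit i tx`: transaction `tx` is placed in the buffer of party `i`;
* `deliver i y t`: party `i`, whose clock shows `t`, receives a sync whose latest event is `y`,
  together with the ancestors of `y`. -/
inductive Step (n ℓ : ℕ) (Tx : Type*) where
  | idle : Step n ℓ Tx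
  | submit (i : Fin n) (tx : Tx) : Step n ℓ Tx
  | deliver (i : Fin n) (y : Event n ℓ Tx) (t : ℕ) : Step n ℓ Tx

/-- The local states of the parties (those of corrupted parties are not used). -/
structure State (n ℓ : ℕ) (Tx : Type*) where
  hashgraph : Fin n → Finset (Event n ℓ Tx)
  latest : Fin n → Event n ℓ Tx
  buffer : Fin n → List Tx

/-- All that an execution of the protocol depends on: clocks and signatures for the genesis events,
the steps, and the signature of the event, if any, that an honest party creates in a given step. -/
structure Script (n ℓ : ℕ) (Tx : Type*) where
  genesisClock : Fin n → ℕ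
  genesisSignature : Fin n → Signature ℓ
  step : ℕ → Step n ℓ Tx
  signature : ℕ → Signature ℓ

section Execution

variable {n ℓ : ℕ} {Tx : Type*}

/-- The event `y` passes the checks of honest parties, `C` being the corrupted parties: `y` and its
ancestors have the right format, and those that bear the signature of an honest party were indeed
created by that party (signatures are unforgeable). The adversary makes all other events as it
likes. -/
def Acceptable (C : Finset (Fin n)) (s : State n ℓ Tx) (y : Event n ℓ Tx) : Prop :=
  ∀ e ∈ y.ancestors, e.WellFormatted ∧ (e.creator ∉ C → e ∈ s.hashgraph e.creator)

/-- Each party starts with its own genesis event, which carries no transactions. -/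
noncomputable def initialState (S : Script n ℓ Tx) : State n ℓ Tx :=
  let g : Fin n → Event n ℓ Tx := fun i =>
    Event.genesis i ⟨[], S.genesisClock i, S.genesisSignature i⟩
  ⟨fun i => {g i}, g, fun _ => []⟩

open Classical in
/-- The effect of a step. An honest party that receives a new acceptable event `y` adds it, with
its ancestors, to its hashgraph and creates a single event, which has `y` as its other-parent and
contains the buffered transactions. -/
noncomputable def nextState (C : Finset (Fin n)) (s : State n ℓ Tx) (σ : Signature ℓ) :
    Step n ℓ Tx → State n ℓ Tx
  | .idle => s
  | .submit i tx => { s with buffer := Function.update s.buffer i (s.buffer i ++ [tx]) }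
  | .deliver i y t =>
    if i ∉ C ∧ y ∉ s.hashgraph i ∧ Acceptable C s y then
      let z := Event.node i (s.latest i) y ⟨s.buffer i, t, σ⟩
      { hashgraph := Function.update s.hashgraph i (insert z (s.hashgraph i ∪ y.ancestors))
        latest := Function.update s.latest i z
        buffer := Function.update s.buffer i [] }
    else s

/-- The state after `k` steps. -/
noncomputable def run (C : Finset (Fin n)) (S : Script n ℓ Tx) : ℕ → State n ℓ Tx
  | 0 => initialState S
  | k + 1 => nextState C (run C S k) (S.signature k) (S.step k)

/-- The hashgraph of party `i` after `k` steps. -/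
noncomputable def hashgraphAt (C : Finset (Fin n)) (S : Script n ℓ Tx) (i : Fin n) (k : ℕ) :
    Finset (Event n ℓ Tx) := (run C S k).hashgraph i

/-- The events that party `i` has output to its write-once log within `k` steps. (The order of the
log is of no concern here.) -/
def eventLog (c : ℕ) (C : Finset (Fin n)) (S : Script n ℓ Tx) (i : Fin n) (k : ℕ) :
    Set (Event n ℓ Tx) :=
  {x | ∃ k' ≤ k, ∃ r, IsRoundReceived c (hashgraphAt C S i k') x r}

/-- The transactions in the log of party `i` after `k` steps. -/
def transactionLog (c : ℕ) (C : Finset (Fin n)) (S : Script n ℓ Tx) (i : Fin n) (k : ℕ) :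
    Set Tx :=
  {tx | ∃ x ∈ eventLog c C S i k, tx ∈ x.data.transactions}

/-- Messages are delivered eventually: whatever event an honest party holds, every honest party
eventually receives. -/
def EventualDelivery (C : Finset (Fin n)) (S : Script n ℓ Tx) : Prop :=
  ∀ i ∉ C, ∀ j ∉ C, ∀ k, ∀ e ∈ hashgraphAt C S i k, ∃ k', e ∈ hashgraphAt C S j k'

end Execution

/-- A random execution, with `𝓕 k` the information available to the adversary before step `k`. The
adversary (and the environment) chooses step `k` with this information; the middle bit of the
signature that an honest party makes in step `k` is a fair coin independent of it, and is revealed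
afterwards; messages are eventually delivered. -/
structure IsRandomExecution {n ℓ : ℕ} {Tx : Type*} {Ω : Type*} [mΩ : MeasurableSpace Ω]
    (C : Finset (Fin n)) (P : Measure Ω) (𝓕 : Filtration ℕ mΩ) (S : Ω → Script n ℓ Tx) : Prop where
  genesisClock : Measurable[𝓕 0, ⊤] fun ω => (S ω).genesisClock
  genesisSignature : Measurable[𝓕 0, ⊤] fun ω => (S ω).genesisSignature
  step : ∀ k, Measurable[𝓕 k, ⊤] fun ω => (S ω).step k
  signature : ∀ k, Measurable[𝓕 (k + 1), ⊤] fun ω => (S ω).signature k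
  coin_fair : ∀ k, P {ω | middleBit ((S ω).signature k) = true} = 1 / 2
  coin_indep : ∀ k, Indep
    (MeasurableSpace.comap (fun ω => middleBit ((S ω).signature k)) ⊤) (𝓕 k) P
  delivery : ∀ᵐ ω ∂P, EventualDelivery C (S ω)

end Hashgraph

/-! The core is that each election is almost surely decided. Its deterministic half is quorum
intersection. Events of an honest party form a chain, so no held event observes a fork of an honest
party, and electors of one creator for two held events of equal round coincide (`Held.electors_eq`).
Eventual delivery drives honest parties through all rounds (`exists_le_round`), and every honest
event is seen by all events of late rounds (`exists_round_sees`). Late witnesses have electors from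
more than 2n/3 parties (`exists_round_hasQuorum`). If the honest coins of a late coin round all
equal the majority vote at one honest witness of that round, then honest witnesses vote alike, one
round later all witnesses do, and a decision follows (`exists_electionDecides`).

The adversary adapts to revealed coins and may interleave the creation of witnesses of different
coin rounds, so these rounds are not independent trials. Each is treated as a bet that its honest
coins equal the majority vote at the honest witness created first. If b honest parties are still
below the round, a standing bet is lost with probability at most 1 - 2^(-b) (`lossBound`). A new
event puts at most one bet at stake, so the product of these bounds over M bets is a supermartingale
(`prod_lossBound_step`). All M bets are lost with probability at most (1 - 2^(-n))^M; almost surely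
infinitely many are won.

Corrupted parties may issue old-round witnesses forever, yet a round must become fully decided for
good. Hence elections are studied for arbitrary first votes: a decider of the all-"no" election held
at time T also decides every witness of that round arriving after T, since none of its ancestors
sees such a witness (`exists_forall_allDecidedUpTo`). -/

open scoped ENNReal

namespace Hashgraph

namespace Event

variable {n ℓ : ℕ} {Tx : Type*}

/-! ### Ancestry and self-ancestor chains. -/

section Ancestors

variable {x y z : Event n ℓ Tx}

theorem self_mem_ancestors (x : Event n ℓ Tx) : x ∈ x.ancestors := by
  cases x <;> simp [ancestors]

theorem self_mem_selfAncestors (x : Event n ℓ Tx) : x ∈ x.selfAncestors := by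
  cases x <;> simp [selfAncestors]

theorem mem_ancestors_node {i : Fin n} {p q : Event n ℓ Tx} {d : EventData ℓ Tx} :
    x ∈ (node i p q d).ancestors ↔ x = node i p q d ∨ x ∈ p.ancestors ∨ x ∈ q.ancestors := by
  simp [ancestors]

theorem mem_selfAncestors_node {i : Fin n} {p q : Event n ℓ Tx} {d : EventData ℓ Tx} :
    x ∈ (node i p q d).selfAncestors ↔ x = node i p q d ∨ x ∈ p.selfAncestors := by
  simp [selfAncestors]

theorem mem_ancestors_trans (hzy : z ∈ y.ancestors) (hyx : y ∈ x.ancestors) :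
    z ∈ x.ancestors := by
  induction x with
  | genesis i d =>
    simp only [ancestors, Finset.mem_singleton] at hyx
    rwa [hyx] at hzy
  | node i p q d ihp ihq =>
    rcases mem_ancestors_node.1 hyx with rfl | h | h
    · exact hzy
    · exact mem_ancestors_node.2 (.inr (.inl (ihp h)))
    · exact mem_ancestors_node.2 (.inr (.inr (ihq h)))

theorem mem_selfAncestors_trans (hzy : z ∈ y.selfAncestors) (hyx : y ∈ x.selfAncestors) :
    z ∈ x.selfAncestors := by
  induction x with
  | genesis i d =>
    simp only [selfAncestors, Finset.mem_singleton] at hyx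
    rwa [hyx] at hzy
  | node i p q d ihp ihq =>
    rcases mem_selfAncestors_node.1 hyx with rfl | h
    · exact hzy
    · exact mem_selfAncestors_node.2 (.inr (ihp h))

theorem selfAncestors_subset_ancestors (x : Event n ℓ Tx) : x.selfAncestors ⊆ x.ancestors := by
  intro y hy
  induction x with
  | genesis i d => simpa [selfAncestors, ancestors] using hy
  | node i p q d ihp ihq =>
    rcases mem_selfAncestors_node.1 hy with rfl | h
    · exact self_mem_ancestors _
    · exact mem_ancestors_node.2 (.inr (.inl (ihp h)))

theorem sizeOf_lt_of_mem_ancestors (h : y ∈ x.ancestors) (hne : y ≠ x) : sizeOf y < sizeOf x := by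
  cases x with
  | genesis i d => simp [ancestors, hne] at h
  | node i p q d =>
    rcases mem_ancestors_node.1 h with h | h | h
    · exact absurd h hne
    · have := sizeOf_le_of_mem_ancestors h
      rw [node.sizeOf_spec]; omega
    · have := sizeOf_le_of_mem_ancestors h
      rw [node.sizeOf_spec]; omega

theorem eq_of_mem_ancestors (h : y ∈ x.ancestors) (h' : x ∈ y.ancestors) : y = x := by
  by_contra hne
  have := sizeOf_lt_of_mem_ancestors h hne
  have := sizeOf_le_of_mem_ancestors h'
  omega

theorem node_notMem_ancestors {i : Fin n} {p q : Event n ℓ Tx} {d : EventData ℓ Tx}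
    (h : x ∈ p.ancestors ∨ x ∈ q.ancestors) : node i p q d ∉ x.ancestors := by
  intro h'
  have := sizeOf_le_of_mem_ancestors h'
  rw [node.sizeOf_spec] at this
  rcases h with h | h <;>
  · have := sizeOf_le_of_mem_ancestors h
    omega

/-- The self-ancestors of an event form a chain. -/
theorem selfAncestors_total (hy : y ∈ x.selfAncestors) (hz : z ∈ x.selfAncestors) :
    y ∈ z.selfAncestors ∨ z ∈ y.selfAncestors := by
  induction x with
  | genesis i d =>
    simp only [selfAncestors, Finset.mem_singleton] at hy hz
    rw [hy, hz]
    exact .inl (self_mem_selfAncestors _)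
  | node i p q d ihp ihq =>
    rcases mem_selfAncestors_node.1 hy with rfl | h
    · exact .inr hz
    rcases mem_selfAncestors_node.1 hz with rfl | h'
    · exact .inl hy
    exact ihp h h'

theorem ObservesFork.mono {i : Fin n} (h : y.ObservesFork i) (hy : y ∈ x.ancestors) :
    x.ObservesFork i := by
  obtain ⟨z, hz, z', hz', hi, hf⟩ := h
  exact ⟨z, mem_ancestors_trans hz hy, z', mem_ancestors_trans hz' hy, hi, hf⟩

end Ancestors

/-! ### Rounds, witnesses and quorums of electors. -/

section Rounds

variable {x y w : Event n ℓ Tx}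

theorem round_node_cases (i : Fin n) (p q : Event n ℓ Tx) (d : EventData ℓ Tx) :
    (node i p q d).round = max p.round q.round ∨
      (node i p q d).round = max p.round q.round + 1 := by
  rw [round_node]
  split_ifs <;> simp

theorem max_round_le_round_node (i : Fin n) (p q : Event n ℓ Tx) (d : EventData ℓ Tx) :
    max p.round q.round ≤ (node i p q d).round := by
  rcases round_node_cases i p q d with h | h <;> omega

theorem round_le_of_mem_ancestors (h : y ∈ x.ancestors) : y.round ≤ x.round := by
  induction x with
  | genesis i d =>
    simp only [ancestors, Finset.mem_singleton] at h
    rw [h]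
  | node i p q d ihp ihq =>
    have := max_round_le_round_node i p q d
    rcases mem_ancestors_node.1 h with rfl | h | h
    · exact le_rfl
    · have := ihp h; omega
    · have := ihq h; omega

/-- Descending through self-parents while the round stays the same ends at a witness. -/
theorem exists_isWitness_mem_selfAncestors (x : Event n ℓ Tx) :
    ∃ w ∈ x.selfAncestors, w.IsWitness ∧ w.round = x.round := by
  induction x with
  | genesis i d => exact ⟨_, self_mem_selfAncestors _, isWitness_genesis i d, rfl⟩
  | node i p q d ihp ihq =>
    have := max_round_le_round_node i p q d
    by_cases h : p.round < (node i p q d).round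
    · exact ⟨_, self_mem_selfAncestors _, (isWitness_node i p q d).2 h, rfl⟩
    · obtain ⟨w, hw, hw', hr⟩ := ihp
      exact ⟨w, mem_selfAncestors_node.2 (.inr hw), hw', by omega⟩

theorem IsWitness.round_lt (hx : x.IsWitness) (h : y ∈ x.selfAncestors) (hne : y ≠ x) :
    y.round < x.round := by
  cases x with
  | genesis i d => simp [selfAncestors, hne] at h
  | node i p q d =>
    rcases mem_selfAncestors_node.1 h with h | h
    · exact absurd h hne
    · exact (round_le_of_mem_ancestors (selfAncestors_subset_ancestors _ h)).trans_lt
        ((isWitness_node i p q d).1 hx)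

/-- Two witnesses of one creator and one round that do not form a fork are equal. -/
theorem IsWitness.eq_of_not_isFork (hx : x.IsWitness) (hy : y.IsWitness)
    (hc : x.creator = y.creator) (hr : x.round = y.round) (h : ¬ IsFork x y) : x = y := by
  by_contra hne
  refine h ⟨hc, fun h => ?_, fun h => ?_⟩
  · have := hy.round_lt h hne; omega
  · have := hx.round_lt h (Ne.symm hne); omega

theorem mem_electors : w ∈ y.electors ↔
    w ∈ y.ancestors ∧ w.IsWitness ∧ w.round + 1 = y.round ∧ y.StronglySees w := by
  simp [electors]

open Classical in
/-- `y` strongly sees witnesses of the preceding round of more than `2n/3` parties. -/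
def HasQuorum (y : Event n ℓ Tx) : Prop := 2 * n < 3 * (y.electors.image creator).card

/-- Only a round above that of both parents comes with a quorum. A witness that inherits its round
from its other-parent may lack one, which is why `exists_round_hasQuorum` is needed later. -/
theorem hasQuorum_node_of_ne {i : Fin n} {p q : Event n ℓ Tx} {d : EventData ℓ Tx}
    (h : (node i p q d).round ≠ max p.round q.round) : (node i p q d).HasQuorum := by
  classical
  have h1 := (round_node_cases i p q d).resolve_left h
  have h2 := round_node i p q d
  split_ifs at h2 with h3
  · refine h3.trans_le (Nat.mul_le_mul_left _ (Finset.card_le_card (Finset.image_subset_image ?_)))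
    intro w hw
    obtain ⟨hw, hr, hw', hs⟩ := Finset.mem_filter.1 hw
    refine mem_electors.2 ⟨mem_ancestors_node.2 (.inr (Finset.mem_union.1 hw)), hw', ?_, hs⟩
    omega
  · exact absurd h2 h

/-- Every event of a round after the first has an ancestor that is a witness of that round and has
a quorum. -/
theorem exists_hasQuorum_mem_ancestors (hx : 2 ≤ x.round) :
    ∃ w ∈ x.ancestors, w.IsWitness ∧ w.round = x.round ∧ w.HasQuorum := by
  induction x with
  | genesis i d => rw [round_genesis] at hx; omega
  | node i p q d ihp ihq =>
    by_cases h : (node i p q d).round = max p.round q.round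
    · rcases max_choice p.round q.round with hm | hm
      · obtain ⟨w, hw, h1, h2, h3⟩ := ihp (by omega)
        exact ⟨w, mem_ancestors_node.2 (.inr (.inl hw)), h1, by omega, h3⟩
      · obtain ⟨w, hw, h1, h2, h3⟩ := ihq (by omega)
        exact ⟨w, mem_ancestors_node.2 (.inr (.inr hw)), h1, by omega, h3⟩
    · have := max_round_le_round_node i p q d
      exact ⟨_, self_mem_ancestors _, (isWitness_node i p q d).2 (by omega), rfl,
        hasQuorum_node_of_ne h⟩

/-- With `C` for `s` this yields an honest elector. -/
theorem HasQuorum.exists_mem_electors {s : Finset (Fin n)} (hx : x.HasQuorum)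
    (hs : 3 * s.card < n) : ∃ w ∈ x.electors, w.creator ∉ s := by
  classical
  by_contra! h
  have : (x.electors.image creator).card ≤ s.card :=
    Finset.card_le_card (Finset.image_subset_iff.2 h)
  unfold HasQuorum at hx
  omega

/-- Rounds are never skipped: below any event of round at least 2 lies a witness with a quorum, and
its electors are exactly one round lower. -/
theorem exists_isWitness_round_eq (hn : 0 < n) {r : ℕ} (hr : 1 ≤ r) (hx : r ≤ x.round) :
    ∃ w ∈ x.ancestors, w.IsWitness ∧ w.round = r := by
  obtain ⟨s, hs⟩ := Nat.exists_eq_add_of_le hx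
  induction s generalizing x with
  | zero =>
    obtain ⟨w, hw, h⟩ := exists_isWitness_mem_selfAncestors x
    exact ⟨w, selfAncestors_subset_ancestors _ hw, h.1, by omega⟩
  | succ s ih =>
    obtain ⟨w, hw, h1, h2, h3⟩ := exists_hasQuorum_mem_ancestors (x := x) (by omega)
    obtain ⟨v, hv, -⟩ := h3.exists_mem_electors (s := ∅) (by simpa using hn)
    obtain ⟨hv1, -, hv2, -⟩ := mem_electors.1 hv
    obtain ⟨u, hu, h⟩ := ih (x := v) (by omega) (by omega)
    exact ⟨u, mem_ancestors_trans hu (mem_ancestors_trans hv1 hw), h⟩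

end Rounds

section Data

/-! The round of an event and its electors do not depend on its transactions, timestamp and
signature. -/

variable {i : Fin n} {p q w : Event n ℓ Tx} {d : EventData ℓ Tx}

/-- The fork may involve the top event itself, which changes with its data. It remains a fork
because the top event is an ancestor of nothing below it, and its proper self-ancestors depend on
`p` alone. -/
theorem observesFork_node_of (d' : EventData ℓ Tx) {j : Fin n}
    (h : (node i p q d).ObservesFork j) : (node i p q d').ObservesFork j := by
  obtain ⟨z, hz, z', hz', hj, hc, h1, h2⟩ := h
  have key : ∀ u : Event n ℓ Tx, (u ∈ p.ancestors ∨ u ∈ q.ancestors) →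
      u ∉ (node i p q d).selfAncestors →
      node i p q d' ∉ u.selfAncestors ∧ u ∉ (node i p q d').selfAncestors := by
    intro u hu hu'
    refine ⟨fun h => node_notMem_ancestors hu (selfAncestors_subset_ancestors _ h), fun h => ?_⟩
    rcases mem_selfAncestors_node.1 h with h | h
    · subst h
      exact node_notMem_ancestors hu (self_mem_ancestors _)
    · exact hu' (mem_selfAncestors_node.2 (.inr h))
  rcases mem_ancestors_node.1 hz with rfl | hz
  · rcases mem_ancestors_node.1 hz' with rfl | hz'
    · exact absurd (self_mem_selfAncestors _) h1
    · exact ⟨_, self_mem_ancestors _, z', mem_ancestors_node.2 (.inr hz'), hj, hc,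
        (key z' hz' h2).1, (key z' hz' h2).2⟩
  · rcases mem_ancestors_node.1 hz' with rfl | hz'
    · exact ⟨z, mem_ancestors_node.2 (.inr hz), _, self_mem_ancestors _, hj, hc,
        (key z hz h1).2, (key z hz h1).1⟩
    · exact ⟨z, mem_ancestors_node.2 (.inr hz), z', mem_ancestors_node.2 (.inr hz'), hj, hc, h1, h2⟩

theorem sees_node_of (d' : EventData ℓ Tx) (hw : w ∈ p.ancestors ∨ w ∈ q.ancestors)
    (h : (node i p q d).Sees w) : (node i p q d').Sees w :=
  ⟨mem_ancestors_node.2 (.inr hw), fun h' => h.2 (observesFork_node_of d h')⟩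

theorem stronglySees_node_of (d' : EventData ℓ Tx) (hw : w ∈ p.ancestors ∨ w ∈ q.ancestors)
    (h : (node i p q d).StronglySees w) : (node i p q d').StronglySees w := by
  classical
  unfold StronglySees at h ⊢
  refine h.trans_le (Nat.mul_le_mul_left _ (Finset.card_le_card ?_))
  intro j hj
  obtain ⟨z, hz, rfl⟩ := Finset.mem_image.1 hj
  obtain ⟨hz, h1, h2⟩ := Finset.mem_filter.1 hz
  rcases mem_ancestors_node.1 hz with rfl | hz
  · refine Finset.mem_image.2 ⟨node i p q d', Finset.mem_filter.2 ⟨self_mem_ancestors _,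
      ⟨self_mem_ancestors _, fun h => h1.2 (observesFork_node_of d h)⟩, sees_node_of d' hw h2⟩, rfl⟩
  · exact Finset.mem_image.2 ⟨z, Finset.mem_filter.2 ⟨mem_ancestors_node.2 (.inr hz),
      sees_node_of d' hz h1, h2⟩, rfl⟩

theorem stronglySees_node_congr (d d' : EventData ℓ Tx)
    (hw : w ∈ p.ancestors ∨ w ∈ q.ancestors) :
    (node i p q d).StronglySees w ↔ (node i p q d').StronglySees w :=
  ⟨stronglySees_node_of d' hw, stronglySees_node_of d hw⟩

theorem round_node_congr (i : Fin n) (p q : Event n ℓ Tx) (d d' : EventData ℓ Tx) :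
    (node i p q d).round = (node i p q d').round := by
  classical
  rw [round_node, round_node]
  have h : (p.ancestors ∪ q.ancestors).filter (fun y => y.round = max p.round q.round ∧
        y.IsWitness ∧ (node i p q d).StronglySees y) =
      (p.ancestors ∪ q.ancestors).filter (fun y => y.round = max p.round q.round ∧
        y.IsWitness ∧ (node i p q d').StronglySees y) :=
    Finset.filter_congr fun y hy => by
      rw [stronglySees_node_congr d d' (Finset.mem_union.1 hy)]
  rw [h]

theorem isWitness_node_congr (i : Fin n) (p q : Event n ℓ Tx) (d d' : EventData ℓ Tx) :
    (node i p q d).IsWitness ↔ (node i p q d').IsWitness := by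
  rw [isWitness_node, isWitness_node, round_node_congr i p q d d']

theorem electors_node_congr (i : Fin n) (p q : Event n ℓ Tx) (d d' : EventData ℓ Tx) :
    (node i p q d).electors = (node i p q d').electors := by
  suffices h : ∀ d d' : EventData ℓ Tx,
      (node i p q d).electors ⊆ (node i p q d').electors from
    (h d d').antisymm (h d' d)
  intro d d' w hw
  obtain ⟨h1, h2, h3, h4⟩ := mem_electors.1 hw
  rcases mem_ancestors_node.1 h1 with rfl | h1
  · omega
  · exact mem_electors.2 ⟨mem_ancestors_node.2 (.inr h1), h2,
      by rw [h3, round_node_congr i p q d d'], stronglySees_node_of d' h1 h4⟩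

/-- The majority vote at a new event is thus fixed before the coin in its signature is tossed. -/
theorem majority_node_congr (f : Event n ℓ Tx → Bool) (i : Fin n) (p q : Event n ℓ Tx)
    (d d' : EventData ℓ Tx) : majority f (node i p q d) = majority f (node i p q d') := by
  have h : ∀ v, tally f (node i p q d) v = tally f (node i p q d') v := fun v => by
    rw [tally, tally, electors_node_congr i p q d d']
  exact decide_eq_decide.2 (by rw [h, h])

end Data

end Event

open Event

/-! ### Invariants of an execution; honest chains and quorum intersection. -/

section Structure

variable {n ℓ : ℕ} {Tx : Type*} {C : Finset (Fin n)} {S : Script n ℓ Tx}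

open Classical in
theorem nextState_cases (C : Finset (Fin n)) (s : State n ℓ Tx) (σ : Signature ℓ)
    (st : Step n ℓ Tx) :
    (∃ i ∉ C, ∃ y t, st = .deliver i y t ∧ y ∉ s.hashgraph i ∧ Acceptable C s y ∧
      (nextState C s σ st).hashgraph = Function.update s.hashgraph i
        (insert (node i (s.latest i) y ⟨s.buffer i, t, σ⟩) (s.hashgraph i ∪ y.ancestors)) ∧
      (nextState C s σ st).latest =
        Function.update s.latest i (node i (s.latest i) y ⟨s.buffer i, t, σ⟩) ∧
      (nextState C s σ st).buffer = Function.update s.buffer i []) ∨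
    ((nextState C s σ st).hashgraph = s.hashgraph ∧ (nextState C s σ st).latest = s.latest ∧
      ∀ i, ∀ tx ∈ s.buffer i, tx ∈ (nextState C s σ st).buffer i) := by
  cases st with
  | idle => exact .inr ⟨rfl, rfl, fun i tx h => h⟩
  | submit i tx =>
    refine .inr ⟨rfl, rfl, fun j tx' h => ?_⟩
    rcases eq_or_ne j i with rfl | hj
    · simpa [nextState] using .inl h
    · simpa [nextState, hj] using h
  | deliver i y t =>
    by_cases h : i ∉ C ∧ y ∉ s.hashgraph i ∧ Acceptable C s y
    · exact .inl ⟨i, h.1, y, t, rfl, h.2.1, h.2.2, by simp only [nextState, if_pos h],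
        by simp only [nextState, if_pos h], by simp only [nextState, if_pos h]⟩
    · have : nextState C s σ (.deliver i y t) = s := by simp only [nextState, if_neg h]
      rw [this]
      exact .inr ⟨rfl, rfl, fun i tx h => h⟩

/-- The invariant of an execution. -/
structure Valid (C : Finset (Fin n)) (s : State n ℓ Tx) : Prop where
  hashgraph_eq : ∀ i, s.hashgraph i = (s.latest i).ancestors
  creator_latest : ∀ i, (s.latest i).creator = i
  acceptable : ∀ i, Acceptable C s (s.latest i)
  mem_selfAncestors : ∀ i ∉ C, ∀ e ∈ s.hashgraph i, e.creator = i → e ∈ (s.latest i).selfAncestors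

theorem valid_initialState (C : Finset (Fin n)) (S : Script n ℓ Tx) :
    Valid C (initialState S) where
  hashgraph_eq i := by simp [initialState, ancestors]
  creator_latest i := by simp [initialState, creator]
  acceptable i := by simp [initialState, Acceptable, ancestors, creator, WellFormatted]
  mem_selfAncestors i _ e he _ := by simpa [initialState, selfAncestors] using he

theorem subset_nextState (C : Finset (Fin n)) (s : State n ℓ Tx) (σ : Signature ℓ)
    (st : Step n ℓ Tx) (i : Fin n) : s.hashgraph i ⊆ (nextState C s σ st).hashgraph i := by
  classical
  rcases nextState_cases C s σ st with ⟨j, -, y, t, -, -, -, h, -⟩ | ⟨h, -⟩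
  · rw [h]
    rcases eq_or_ne i j with rfl | hj
    · rw [Function.update_self]
      exact fun e he => Finset.mem_insert_of_mem (Finset.mem_union_left _ he)
    · rw [Function.update_of_ne hj]
  · rw [h]

theorem Acceptable.nextState {s : State n ℓ Tx} {y : Event n ℓ Tx} (h : Acceptable C s y)
    (σ : Signature ℓ) (st : Step n ℓ Tx) : Acceptable C (nextState C s σ st) y :=
  fun e he => ⟨(h e he).1, fun hC => subset_nextState C s σ st _ ((h e he).2 hC)⟩

theorem Valid.nextState {s : State n ℓ Tx} (hs : Valid C s) (σ : Signature ℓ)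
    (st : Step n ℓ Tx) : Valid C (nextState C s σ st) := by
  classical
  rcases nextState_cases C s σ st with ⟨i, hi, y, t, -, -, hy, hH, hL, -⟩ | ⟨hH, hL, -⟩
  · have key : ∀ j ≠ i, (Hashgraph.nextState C s σ st).hashgraph j = s.hashgraph j ∧
        (Hashgraph.nextState C s σ st).latest j = s.latest j := fun j hj => by
      rw [hH, hL, Function.update_of_ne hj, Function.update_of_ne hj]
      exact ⟨rfl, rfl⟩
    have hHi := congrFun hH i
    have hLi := congrFun hL i
    rw [Function.update_self] at hHi hLi
    refine ⟨fun j => ?_, fun j => ?_, fun j => ?_, fun j hj => ?_⟩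
    · rcases eq_or_ne j i with rfl | hj
      · rw [hHi, hLi, hs.hashgraph_eq j]
        ext e
        simp only [Finset.mem_insert, Finset.mem_union, mem_ancestors_node]
      · rw [(key j hj).1, (key j hj).2, hs.hashgraph_eq j]
    · rcases eq_or_ne j i with rfl | hj
      · rw [hLi]; rfl
      · rw [(key j hj).2, hs.creator_latest j]
    · rcases eq_or_ne j i with rfl | hj
      · rw [hLi]
        intro e he
        rcases mem_ancestors_node.1 he with rfl | he | he
        · refine ⟨hs.creator_latest j, fun _ => ?_⟩
          simp only [creator]
          rw [hHi]
          exact Finset.mem_insert_self _ _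
        · exact (hs.acceptable j).nextState σ st e he
        · exact hy.nextState σ st e he
      · rw [(key j hj).2]
        exact (hs.acceptable j).nextState σ st
    · rcases eq_or_ne j i with rfl | hj'
      · intro e he hej
        rw [hHi] at he
        rw [hLi]
        rcases Finset.mem_insert.1 he with rfl | he
        · exact self_mem_selfAncestors _
        refine mem_selfAncestors_node.2 (.inr (hs.mem_selfAncestors j hj e ?_ hej))
        rcases Finset.mem_union.1 he with he | he
        · exact he
        -- Unforgeability: a received event brings no events of `j` that `j` has not itself created,
        -- so the chain of `j` stays a chain.
        · have := (hy e he).2 (by rwa [hej])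
          rwa [hej] at this
      · rw [(key j hj').1, (key j hj').2]
        exact hs.mem_selfAncestors j hj
  · refine ⟨?_, ?_, fun i => ?_, ?_⟩
    · rw [hH, hL]; exact hs.hashgraph_eq
    · rw [hL]; exact hs.creator_latest
    · rw [hL]; exact (hs.acceptable i).nextState σ st
    · rw [hH, hL]; exact hs.mem_selfAncestors

theorem valid_run (C : Finset (Fin n)) (S : Script n ℓ Tx) (k : ℕ) : Valid C (run C S k) := by
  induction k with
  | zero => exact valid_initialState C S
  | succ k ih => exact ih.nextState _ _

/-- The last event that party `i` has created within `k` steps. -/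
noncomputable abbrev latestAt (C : Finset (Fin n)) (S : Script n ℓ Tx) (i : Fin n) (k : ℕ) :
    Event n ℓ Tx := (run C S k).latest i

theorem mem_hashgraphAt {i : Fin n} {k : ℕ} {e : Event n ℓ Tx} :
    e ∈ hashgraphAt C S i k ↔ e ∈ (latestAt C S i k).ancestors := by
  rw [hashgraphAt, (valid_run C S k).hashgraph_eq]

theorem creator_latestAt (i : Fin n) (k : ℕ) : (latestAt C S i k).creator = i :=
  (valid_run C S k).creator_latest i

theorem hashgraphAt_mono (i : Fin n) : Monotone (hashgraphAt C S i) :=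
  monotone_nat_of_le_succ fun k => subset_nextState C (run C S k) _ _ i

theorem latestAt_mem_selfAncestors (i : Fin n) {k k' : ℕ} (h : k ≤ k') :
    latestAt C S i k ∈ (latestAt C S i k').selfAncestors := by
  induction k', h using Nat.le_induction with
  | base => exact self_mem_selfAncestors _
  | succ m _ ih =>
    refine mem_selfAncestors_trans ih ?_
    change (run C S m).latest i ∈ ((nextState C (run C S m) _ _).latest i).selfAncestors
    rcases nextState_cases C (run C S m) (S.signature m) (S.step m) with
      ⟨j, -, y, t, -, -, -, -, hL, -⟩ | ⟨-, hL, -⟩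
    · rw [hL]
      rcases eq_or_ne i j with rfl | hj
      · rw [Function.update_self]
        exact mem_selfAncestors_node.2 (.inr (self_mem_selfAncestors _))
      · rw [Function.update_of_ne hj]
        exact self_mem_selfAncestors _
    · rw [hL]
      exact self_mem_selfAncestors _

theorem latestAt_mem_ancestors (i : Fin n) {k k' : ℕ} (h : k ≤ k') :
    latestAt C S i k ∈ (latestAt C S i k').ancestors :=
  selfAncestors_subset_ancestors _ (latestAt_mem_selfAncestors i h)

/-- Some honest party holds the event `e` at some time. -/
def Held (C : Finset (Fin n)) (S : Script n ℓ Tx) (e : Event n ℓ Tx) : Prop :=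
  ∃ i ∉ C, ∃ k, e ∈ hashgraphAt C S i k

variable {e e' x x' y y' : Event n ℓ Tx}

theorem held_latestAt {i : Fin n} (hi : i ∉ C) (k : ℕ) : Held C S (latestAt C S i k) :=
  ⟨i, hi, k, mem_hashgraphAt.2 (self_mem_ancestors _)⟩

theorem Held.of_mem_ancestors (he : Held C S e) (h : e' ∈ e.ancestors) : Held C S e' := by
  obtain ⟨i, hi, k, hk⟩ := he
  exact ⟨i, hi, k, mem_hashgraphAt.2 (mem_ancestors_trans h (mem_hashgraphAt.1 hk))⟩

/-- An accepted event of an honest creator lies in the creator's own hashgraph, where all its events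
are on one self-ancestor chain. -/
theorem Held.exists_mem_selfAncestors (he : Held C S e) (hC : e.creator ∉ C) :
    ∃ k, ∀ k' ≥ k, e ∈ (latestAt C S e.creator k').selfAncestors := by
  obtain ⟨i, hi, k, hk⟩ := he
  refine ⟨k, fun k' hk' => mem_selfAncestors_trans ?_ (latestAt_mem_selfAncestors _ hk')⟩
  exact (valid_run C S k).mem_selfAncestors _ hC e
    (((valid_run C S k).acceptable i e (mem_hashgraphAt.1 hk)).2 hC) rfl

/-- Events of an honest party form a chain. -/
theorem Held.mem_selfAncestors_or (he : Held C S e) (he' : Held C S e')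
    (h : e.creator = e'.creator) (hC : e.creator ∉ C) :
    e ∈ e'.selfAncestors ∨ e' ∈ e.selfAncestors := by
  obtain ⟨k, hk⟩ := he.exists_mem_selfAncestors hC
  obtain ⟨k', hk'⟩ := he'.exists_mem_selfAncestors (h ▸ hC)
  exact selfAncestors_total (hk (max k k') (le_max_left _ _))
    (h ▸ hk' (max k k') (le_max_right _ _))

theorem Held.not_observesFork (hx : Held C S x) {i : Fin n} (hi : i ∉ C) :
    ¬ x.ObservesFork i := by
  rintro ⟨z, hz, z', hz', rfl, hc, h1, h2⟩
  rcases (hx.of_mem_ancestors hz).mem_selfAncestors_or (hx.of_mem_ancestors hz') hc hi with h | h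
  · exact h1 h
  · exact h2 h

theorem Held.sees (hx : Held C S x) (hy : y ∈ x.ancestors) (hC : y.creator ∉ C) : x.Sees y :=
  ⟨hy, hx.not_observesFork hC⟩

/-- Honest parties alone exceed 2n/3, and no held event observes a fork of theirs. -/
theorem Held.stronglySees (hx : Held C S x) (hC : 3 * C.card < n)
    (h : ∀ j ∉ C, ∃ z ∈ x.ancestors, z.creator = j ∧ z.Sees y) : x.StronglySees y := by
  classical
  have : Cᶜ ⊆ (x.ancestors.filter fun z => x.Sees z ∧ z.Sees y).image creator := by
    intro j hj
    obtain ⟨z, hz, rfl, hzy⟩ := h j (Finset.mem_compl.1 hj)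
    exact Finset.mem_image.2 ⟨z, Finset.mem_filter.2
      ⟨hz, hx.sees hz (Finset.mem_compl.1 hj), hzy⟩, rfl⟩
  have := Finset.card_le_card this
  rw [Finset.card_compl, Fintype.card_fin] at this
  unfold StronglySees
  omega

/-- Two supermajorities have an honest party in common. -/
theorem exists_mem_inter_notMem (hC : 3 * C.card < n) {A B : Finset (Fin n)}
    (hA : 2 * n < 3 * A.card) (hB : 2 * n < 3 * B.card) : ∃ i ∈ A, i ∈ B ∧ i ∉ C := by
  classical
  by_contra! h
  have h1 : (A ∩ B).card ≤ C.card := Finset.card_le_card fun i hi =>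
    h i (Finset.mem_inter.1 hi).1 (Finset.mem_inter.1 hi).2
  have h2 := Finset.card_union_add_card_inter A B
  have h3 : (A ∪ B).card ≤ n := by simpa using Finset.card_le_univ (A ∪ B)
  omega

/-- Forks are never strongly seen by events that honest parties hold. -/
theorem Held.not_isFork_of_stronglySees (hC : 3 * C.card < n) (hx : Held C S x)
    (hx' : Held C S x') (h : x.StronglySees y) (h' : x'.StronglySees y') : ¬ IsFork y y' := by
  classical
  intro hf
  obtain ⟨i, hi, hi', hiC⟩ := exists_mem_inter_notMem hC h h'
  obtain ⟨z, hz, rfl⟩ := Finset.mem_image.1 hi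
  obtain ⟨z', hz', hzz⟩ := Finset.mem_image.1 hi'
  obtain ⟨hz, -, hzy⟩ := Finset.mem_filter.1 hz
  obtain ⟨hz', -, hzy'⟩ := Finset.mem_filter.1 hz'
  -- Both intermediaries belong to one honest party, so the later one has `y` and `y'` among its
  -- ancestors. It observes the fork and cannot see either.
  rcases (hx.of_mem_ancestors hz).mem_selfAncestors_or (hx'.of_mem_ancestors hz') hzz.symm hiC
    with h | h
  · exact hzy'.2 ⟨y, mem_ancestors_trans hzy.1 (selfAncestors_subset_ancestors _ h), y', hzy'.1,
      hf.1, hf⟩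
  · exact hzy.2 ⟨y, hzy.1, y', mem_ancestors_trans hzy'.1 (selfAncestors_subset_ancestors _ h),
      rfl, hf⟩

/-- Strongly seen events do not fork, and non-forking witnesses of one creator and round are equal.
This makes the tallies of different events comparable even when corrupted parties fork. -/
theorem Held.electors_eq (hC : 3 * C.card < n) (hx : Held C S x) (hx' : Held C S x')
    (hr : x.round = x'.round) (hy : y ∈ x.electors) (hy' : y' ∈ x'.electors)
    (hc : y.creator = y'.creator) : y = y' := by
  obtain ⟨-, h1, h2, h3⟩ := mem_electors.1 hy
  obtain ⟨-, h1', h2', h3'⟩ := mem_electors.1 hy'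
  exact h1.eq_of_not_isFork h1' hc (by omega) (hx.not_isFork_of_stronglySees hC hx' h3 h3')

theorem creator_of_mem_selfAncestors (h : ∀ u ∈ x.ancestors, u.WellFormatted)
    (hy : y ∈ x.selfAncestors) : y.creator = x.creator := by
  induction x with
  | genesis i d =>
    simp only [selfAncestors, Finset.mem_singleton] at hy
    rw [hy]
  | node i p q d ihp ihq =>
    rcases mem_selfAncestors_node.1 hy with rfl | hy
    · rfl
    · rw [ihp (fun u hu => h u (mem_ancestors_node.2 (.inr (.inl hu)))) hy]
      exact h _ (self_mem_ancestors _)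

theorem creator_of_mem_selfAncestors_latestAt {i : Fin n} {k : ℕ}
    (h : y ∈ (latestAt C S i k).selfAncestors) : y.creator = i := by
  rw [creator_of_mem_selfAncestors (fun u hu => ((valid_run C S k).acceptable i u hu).1) h,
    creator_latestAt]

end Structure

/-! ### Growth of rounds, and what late events have in common. -/

section Progress

variable {n ℓ : ℕ} {Tx : Type*} {C : Finset (Fin n)} {S : Script n ℓ Tx} {e x y : Event n ℓ Tx}

theorem EventualDelivery.exists_forall_mem (hS : EventualDelivery C S) (he : Held C S e) (k : ℕ) :
    ∃ k' ≥ k, ∀ j ∉ C, e ∈ hashgraphAt C S j k' := by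
  obtain ⟨i, hi, m, hm⟩ := he
  have : ∀ j, ∃ k', j ∉ C → e ∈ hashgraphAt C S j k' := fun j => by
    by_cases hj : j ∈ C
    · exact ⟨0, fun h => absurd hj h⟩
    · obtain ⟨k', hk'⟩ := hS i hi j hj m e hm
      exact ⟨k', fun _ => hk'⟩
  choose f hf using this
  exact ⟨max k (Finset.univ.sup f), le_max_left _ _, fun j hj =>
    hashgraphAt_mono j (le_max_of_le_right (Finset.le_sup (Finset.mem_univ j))) (hf j hj)⟩

theorem EventualDelivery.exists_forall_latestAt (hS : EventualDelivery C S) (k : ℕ) :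
    ∃ k' ≥ k, ∀ i ∉ C, ∀ j ∉ C, latestAt C S i k ∈ (latestAt C S j k').ancestors := by
  have : ∀ i, ∃ k' ≥ k, i ∉ C → ∀ j ∉ C, latestAt C S i k ∈ hashgraphAt C S j k' := fun i => by
    by_cases hi : i ∈ C
    · exact ⟨k, le_rfl, fun h => absurd hi h⟩
    · obtain ⟨k', hk, h⟩ := hS.exists_forall_mem (held_latestAt hi k) k
      exact ⟨k', hk, fun _ => h⟩
  choose f hk hf using this
  exact ⟨max k (Finset.univ.sup f), le_max_left _ _, fun i hi j hj => mem_hashgraphAt.1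
    (hashgraphAt_mono j (le_max_of_le_right (Finset.le_sup (Finset.mem_univ i))) (hf i hi j hj))⟩

theorem exists_ne_notMem (hn : 2 ≤ n) (hC : 3 * C.card < n) (l : Fin n) : ∃ j ∉ C, j ≠ l := by
  classical
  by_contra! h
  have h1 : (Finset.univ : Finset (Fin n)) ⊆ insert l C := fun j _ => by
    by_cases hj : j ∈ C
    · exact Finset.mem_insert_of_mem hj
    · rw [h j hj]; exact Finset.mem_insert_self _ _
  have h2 := (Finset.card_le_card h1).trans (Finset.card_insert_le _ _)
  rw [Finset.card_univ, Fintype.card_fin] at h2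
  omega

/-- If every honest party has reached round `R`, then some honest party reaches round `R + 1`. -/
theorem EventualDelivery.exists_round_lt (hS : EventualDelivery C S) (hn : 2 ≤ n)
    (hC : 3 * C.card < n) {R k : ℕ} (hR : ∀ j ∉ C, R ≤ (latestAt C S j k).round) :
    ∃ l ∉ C, ∃ k', R < (latestAt C S l k').round := by
  classical
  by_contra! hmax
  have hround : ∀ j ∉ C, ∀ k' ≥ k, (latestAt C S j k').round = R := fun j hj k' hk' =>
    (hmax j hj k').antisymm
      ((hR j hj).trans (round_le_of_mem_ancestors (latestAt_mem_ancestors j hk')))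
  -- Two waves of delivery: at `k1` every honest latest event sees all honest witnesses of round
  -- `R`, and at `k2` party `l` has all those events below it, hence strongly sees the witnesses.
  obtain ⟨k1, hk1, h1⟩ := hS.exists_forall_latestAt k
  obtain ⟨k2, hk2, h2⟩ := hS.exists_forall_latestAt k1
  obtain ⟨l, hl, -⟩ := exists_ne_notMem hn hC ⟨0, by omega⟩
  -- `round_node` counts only proper ancestors. Routing through a second honest party shows that the
  -- latest event of `l` is neither a genesis event nor one of the witnesses `w i`.
  obtain ⟨j, hj, hjl⟩ := exists_ne_notMem hn hC l
  choose w hw hww hwr using fun i => exists_isWitness_mem_selfAncestors (latestAt C S i k)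
  have hwi : ∀ i, (w i).creator = i := fun i => creator_of_mem_selfAncestors_latestAt (hw i)
  have hw1 : ∀ i ∉ C, ∀ u ∉ C, w i ∈ (latestAt C S u k1).ancestors := fun i hi u hu =>
    mem_ancestors_trans (selfAncestors_subset_ancestors _ (hw i)) (h1 i hi u hu)
  have hw2 : ∀ i ∉ C, w i ∈ (latestAt C S l k2).ancestors := fun i hi =>
    mem_ancestors_trans (hw1 i hi j hj) (h2 j hj l hl)
  have hne : ∀ i ∉ C, w i ≠ latestAt C S l k2 := by
    intro i hi heq
    have h3 := hw1 i hi j hj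
    rw [heq] at h3
    have h4 := eq_of_mem_ancestors h3 (h2 j hj l hl)
    have h5 := congrArg creator h4
    rw [creator_latestAt, creator_latestAt] at h5
    exact hjl h5.symm
  have hstrong : ∀ i ∉ C, (latestAt C S l k2).StronglySees (w i) := fun i hi =>
    (held_latestAt hl k2).stronglySees hC fun u hu =>
      ⟨latestAt C S u k1, h2 u hu l hl, creator_latestAt u k1,
        (held_latestAt hu k1).sees (hw1 i hi u hu) (by rwa [hwi])⟩
  have hLr := hround l hl k2 (hk1.trans hk2)
  have hLheld := held_latestAt (S := S) hl k2
  have hj2 := h2 j hj l hl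
  have hlk : (latestAt C S l k2).creator = l := creator_latestAt l k2
  generalize latestAt C S l k2 = L at *
  cases L with
  | genesis i d =>
    simp only [ancestors, Finset.mem_singleton] at hj2
    have h5 := congrArg creator hj2
    rw [creator_latestAt, hlk] at h5
    exact hjl h5
  | node i p q d =>
    have hpq : ∀ u ∉ C, w u ∈ p.ancestors ∪ q.ancestors := fun u hu =>
      Finset.mem_union.2 ((mem_ancestors_node.1 (hw2 u hu)).resolve_left (hne u hu))
    have hwR : ∀ u ∉ C, (w u).round = R := fun u hu => (hwr u).trans (hround u hu k le_rfl)
    have hm : max p.round q.round = R := by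
      refine (hLr ▸ max_round_le_round_node i p q d).antisymm ?_
      have := hwR l hl
      rcases Finset.mem_union.1 (hpq l hl) with h | h <;>
      · have := round_le_of_mem_ancestors h
        omega
    have hnode := round_node i p q d
    rw [if_pos, hm, hLr] at hnode
    · omega
    have hsub : Cᶜ ⊆ ((p.ancestors ∪ q.ancestors).filter fun y =>
        y.round = max p.round q.round ∧ y.IsWitness ∧
          (node i p q d).StronglySees y).image creator := fun u hu => by
      have hu := Finset.mem_compl.1 hu
      exact Finset.mem_image.2 ⟨w u, Finset.mem_filter.2 ⟨hpq u hu, (hwR u hu).trans hm.symm,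
        hww u, hstrong u hu⟩, hwi u⟩
    have := Finset.card_le_card hsub
    rw [Finset.card_compl, Fintype.card_fin] at this
    omega

/-- Every honest party reaches every round. -/
theorem EventualDelivery.exists_le_round (hS : EventualDelivery C S) (hn : 2 ≤ n)
    (hC : 3 * C.card < n) (R : ℕ) : ∃ k, ∀ j ∉ C, R ≤ (latestAt C S j k).round := by
  induction R with
  | zero => exact ⟨0, fun j _ => Nat.zero_le _⟩
  | succ R ih =>
    obtain ⟨k, hk⟩ := ih
    obtain ⟨l, hl, k', hk'⟩ := hS.exists_round_lt hn hC hk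
    obtain ⟨k'', -, h⟩ := hS.exists_forall_latestAt k'
    exact ⟨k'', fun j hj => hk'.trans_le (round_le_of_mem_ancestors (h l hl j hj))⟩

/-- Events of sufficiently late rounds descend from the events that honest parties have created
up to a given time. -/
theorem exists_round_latestAt_mem_ancestors (hC : 3 * C.card < n) (k : ℕ) :
    ∃ R ≥ 1, ∀ e, Held C S e → R ≤ e.round →
      ∃ j ∉ C, latestAt C S j k ∈ e.ancestors := by
  -- Electors are one round lower, so `+ 2` keeps them strictly above the rounds reached at time
  -- `k`. An honest elector then comes after its creator's latest event of time `k`.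
  refine ⟨Finset.univ.sup (fun j => (latestAt C S j k).round) + 2, by omega, fun e he hr => ?_⟩
  obtain ⟨q, hq, hqw, hqr, hqq⟩ := exists_hasQuorum_mem_ancestors (x := e) (by omega)
  obtain ⟨w, hw, hwC⟩ := hqq.exists_mem_electors hC
  obtain ⟨hwq, -, hwr, -⟩ := mem_electors.1 hw
  have hwe := mem_ancestors_trans hwq hq
  refine ⟨w.creator, hwC, mem_ancestors_trans ?_ hwe⟩
  have hlt : (latestAt C S w.creator k).round < w.round := by
    have := Finset.le_sup (f := fun j => (latestAt C S j k).round) (Finset.mem_univ w.creator)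
    omega
  rcases (held_latestAt hwC k).mem_selfAncestors_or (he.of_mem_ancestors hwe)
    (creator_latestAt w.creator k) (by rwa [creator_latestAt]) with h | h
  · exact selfAncestors_subset_ancestors _ h
  · have := round_le_of_mem_ancestors (selfAncestors_subset_ancestors _ h)
    omega

/-- An honest event is seen by all events of sufficiently late rounds. -/
theorem EventualDelivery.exists_round_sees (hS : EventualDelivery C S) (hC : 3 * C.card < n)
    (hx : Held C S x) (hxC : x.creator ∉ C) :
    ∃ R ≥ 1, ∀ e, Held C S e → R ≤ e.round → e.Sees x := by
  obtain ⟨k, -, hk⟩ := hS.exists_forall_mem hx 0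
  obtain ⟨R, hR1, hR⟩ := exists_round_latestAt_mem_ancestors (S := S) hC k
  refine ⟨R, hR1, fun e he hr => he.sees ?_ hxC⟩
  obtain ⟨j, hj, hje⟩ := hR e he hr
  exact mem_ancestors_trans (mem_hashgraphAt.1 (hk j hj)) hje

/-- Late events all observe forks of the same parties, whence late witnesses have quorums. -/
theorem EventualDelivery.exists_round_hasQuorum (hS : EventualDelivery C S)
    (hC : 3 * C.card < n) :
    ∃ R, ∀ y, Held C S y → R ≤ y.round → y.HasQuorum := by
  classical
  -- For each of the finitely many parties, either no held event ever observes a fork of it, or from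
  -- some time on all honest latest events do.
  have hF : ∀ a, ∃ k, ∀ e, Held C S e → e.ObservesFork a →
      ∀ j ∉ C, (latestAt C S j k).ObservesFork a := fun a => by
    by_cases h : ∃ e, Held C S e ∧ e.ObservesFork a
    · obtain ⟨e, he, hea⟩ := h
      obtain ⟨k, -, hk⟩ := hS.exists_forall_mem he 0
      exact ⟨k, fun _ _ _ j hj => hea.mono (mem_hashgraphAt.1 (hk j hj))⟩
    · exact ⟨0, fun e he hea => absurd ⟨e, he, hea⟩ h⟩
  choose f hf using hF
  obtain ⟨R, hR1, hR⟩ := exists_round_latestAt_mem_ancestors (S := S) hC (Finset.univ.sup f)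
  have key : ∀ e, Held C S e → ∀ e', Held C S e' → R ≤ e'.round → ∀ a, e.ObservesFork a →
      e'.ObservesFork a := by
    intro e he e' he' hr a ha
    obtain ⟨j, hj, hje⟩ := hR e' he' hr
    exact ((hf a e he ha j hj).mono
      (latestAt_mem_ancestors j (Finset.le_sup (Finset.mem_univ a)))).mono hje
  refine ⟨R + 2, fun y hy hr => ?_⟩
  -- In general `y` may observe more forks than its ancestor `q` and strongly see less. Here `q` is
  -- late enough to observe them all, so its electors are electors of `y`.
  obtain ⟨q, hq, hqw, hqr, hqq⟩ := exists_hasQuorum_mem_ancestors (x := y) (by omega)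
  refine hqq.trans_le (Nat.mul_le_mul_left _ (Finset.card_le_card
    (Finset.image_subset_image fun w hw => ?_)))
  obtain ⟨h1, h2, h3, h4⟩ := mem_electors.1 hw
  refine mem_electors.2 ⟨mem_ancestors_trans h1 hq, h2, by omega, ?_⟩
  refine h4.trans_le (Nat.mul_le_mul_left _ (Finset.card_le_card
    (Finset.image_subset_image fun z hz => ?_)))
  obtain ⟨hz1, hz2, hz3⟩ := Finset.mem_filter.1 hz
  exact Finset.mem_filter.2 ⟨mem_ancestors_trans hz1 hq, ⟨mem_ancestors_trans hz1 hq,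
    fun h => hz2.2 (key y hy q (hy.of_mem_ancestors hq) (by omega) _ h)⟩, hz3⟩

/-- A submitted transaction is contained in a later event of the party. -/
theorem EventualDelivery.exists_mem_transactions (hS : EventualDelivery C S) (hn : 2 ≤ n)
    (hC : 3 * C.card < n) {i : Fin n} (hi : i ∉ C) {k : ℕ} {tx : Tx}
    (hk : S.step k = .submit i tx) :
    ∃ k', ∃ x ∈ hashgraphAt C S i k', x.creator = i ∧ tx ∈ x.data.transactions := by
  by_contra! hcon
  -- The next event of `i` would carry the transaction, so without such an event `i` is stuck,
  -- although its round must grow.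
  have key : ∀ k' ≥ k + 1, latestAt C S i k' = latestAt C S i (k + 1) ∧
      tx ∈ (run C S k').buffer i := by
    intro k' hk'
    induction k', hk' using Nat.le_induction with
    | base =>
      refine ⟨rfl, ?_⟩
      simp [run, hk, nextState]
    | succ m hm ih =>
      have hL' : latestAt C S i (m + 1) = (nextState C (run C S m) _ _).latest i := rfl
      have hB' : (run C S (m + 1)).buffer i = (nextState C (run C S m) _ _).buffer i := rfl
      rw [hL', hB', ← ih.1]
      rcases nextState_cases C (run C S m) (S.signature m) (S.step m) with
        ⟨j, -, y, t, -, -, -, -, hL, hB⟩ | ⟨-, hL, hB⟩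
      · rcases eq_or_ne i j with rfl | hj
        · rw [hL, Function.update_self] at hL'
          refine absurd ih.2 ?_
          have := hcon (m + 1) _ (mem_hashgraphAt.2 (self_mem_ancestors _)) (creator_latestAt _ _)
          rwa [hL'] at this
        · rw [hL, hB, Function.update_of_ne hj, Function.update_of_ne hj]
          exact ⟨rfl, ih.2⟩
      · rw [hL]
        exact ⟨rfl, hB i tx ih.2⟩
  obtain ⟨k', hk'⟩ := hS.exists_le_round hn hC ((latestAt C S i (k + 1)).round + 1)
  have h1 := hk' i hi
  have h2 := round_le_of_mem_ancestors (latestAt_mem_ancestors (C := C) (S := S) i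
    (le_max_left k' (k + 1)))
  rw [(key _ (le_max_right k' (k + 1))).1] at h2
  omega

end Progress

/-! ### Elections with arbitrary first votes. -/

namespace Event

variable {n ℓ : ℕ} {Tx : Type*}

/-- The votes in an election whose first votes are given by `f`. -/
noncomputable def electionVote (c : ℕ) (f : Event n ℓ Tx → Bool) : ℕ → Event n ℓ Tx → Bool
  | 0, _ => false
  | 1, y => f y
  | d + 2, y =>
    let v := majority (electionVote c f (d + 1)) y
    if (d + 2) % c = 0 ∧ ¬ 2 * n < 3 * tally (electionVote c f (d + 1)) y v then
      middleBit y.data.signature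
    else v

/-- The witness `y` decides `v` in the election on a round-`r` witness with first votes `f`. -/
def ElectionDecides (c : ℕ) (f : Event n ℓ Tx → Bool) (r : ℕ) (y : Event n ℓ Tx) (v : Bool) :
    Prop :=
  y.IsWitness ∧ r + 2 ≤ y.round ∧ (y.round - r) % c ≠ 0 ∧
    v = majority (electionVote c f (y.round - r - 1)) y ∧
    2 * n < 3 * tally (electionVote c f (y.round - r - 1)) y v

open Classical in
/-- The first votes in the election on the fame of `x`. -/
noncomputable def firstVote (x y : Event n ℓ Tx) : Bool := decide (y.Sees x)

theorem voteAt_eq_electionVote (c : ℕ) (x : Event n ℓ Tx) (d : ℕ) :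
    voteAt c x d = electionVote c (firstVote x) d := by
  induction d using Nat.strong_induction_on with
  | _ d ih =>
    match d with
    | 0 => funext y; simp only [voteAt, electionVote]
    | 1 => funext y; simp only [voteAt, electionVote, firstVote]
    | d + 2 =>
      funext y
      simp only [voteAt, electionVote, ih (d + 1) (by omega)]

theorem decides_iff {c : ℕ} {x y : Event n ℓ Tx} {v : Bool} :
    Decides c x y v ↔ ElectionDecides c (firstVote x) x.round y v := by
  simp only [Decides, ElectionDecides, voteAt_eq_electionVote]

theorem electionVote_of_two_le {c d : ℕ} (hd : 2 ≤ d) (f : Event n ℓ Tx → Bool)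
    (y : Event n ℓ Tx) :
    electionVote c f d y =
      if d % c = 0 ∧
          ¬ 2 * n < 3 * tally (electionVote c f (d - 1)) y (majority (electionVote c f (d - 1)) y)
      then middleBit y.data.signature else majority (electionVote c f (d - 1)) y := by
  obtain ⟨d, rfl⟩ := Nat.exists_eq_add_of_le' hd
  simp only [electionVote, Nat.add_succ_sub_one]

theorem tally_congr {f g : Event n ℓ Tx → Bool} {y : Event n ℓ Tx}
    (h : ∀ w ∈ y.electors, f w = g w) (v : Bool) : tally f y v = tally g y v := by
  unfold tally
  rw [Finset.filter_congr fun w hw => by rw [h w hw]]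

theorem majority_congr {f g : Event n ℓ Tx → Bool} {y : Event n ℓ Tx}
    (h : ∀ w ∈ y.electors, f w = g w) : majority f y = majority g y :=
  decide_eq_decide.2 (by rw [tally_congr h, tally_congr h])

theorem electionVote_congr {c : ℕ} {f g : Event n ℓ Tx → Bool} {y : Event n ℓ Tx}
    (h : ∀ w ∈ y.ancestors, f w = g w) (d : ℕ) : electionVote c f d y = electionVote c g d y := by
  induction d using Nat.strong_induction_on generalizing y with
  | _ d ih =>
    match d with
    | 0 => simp only [electionVote]
    | 1 => simpa only [electionVote] using h y (self_mem_ancestors y)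
    | d + 2 =>
      have key : ∀ w ∈ y.electors, electionVote c f (d + 1) w = electionVote c g (d + 1) w :=
        fun w hw => ih (d + 1) (by omega) fun u hu =>
          h u (mem_ancestors_trans hu (mem_electors.1 hw).1)
      simp only [electionVote, majority_congr key, tally_congr key]

/-- Votes are computed from electors, which are ancestors. Used to transfer a decision of the
all-"no" election to a witness that no ancestor of the decider sees. -/
theorem ElectionDecides.congr {c r : ℕ} {f g : Event n ℓ Tx → Bool} {y : Event n ℓ Tx} {v : Bool}
    (hy : ElectionDecides c f r y v) (h : ∀ w ∈ y.ancestors, f w = g w) :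
    ElectionDecides c g r y v := by
  obtain ⟨h1, h2, h3, h4, h5⟩ := hy
  have key : ∀ w ∈ y.electors, electionVote c f (y.round - r - 1) w =
      electionVote c g (y.round - r - 1) w := fun w hw =>
    electionVote_congr (fun u hu => h u (mem_ancestors_trans hu (mem_electors.1 hw).1)) _
  rw [majority_congr key] at h4
  rw [tally_congr key] at h5
  exact ⟨h1, h2, h3, h4, h5⟩

theorem majority_eq_of_tally_lt {f : Event n ℓ Tx → Bool} {y : Event n ℓ Tx} {v : Bool}
    (h : tally f y (!v) < tally f y v) : majority f y = v := by
  cases v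
  · exact decide_eq_false (not_le.2 h)
  · exact decide_eq_true (le_of_lt h)

theorem tally_add_tally (f : Event n ℓ Tx → Bool) (y : Event n ℓ Tx) (v : Bool) :
    tally f y v + tally f y (!v) = y.electors.card := by
  unfold tally
  rw [← Finset.card_filter_add_card_filter_not (s := y.electors) (fun z => f z = v)]
  congr 2
  refine Finset.filter_congr fun w _ => ?_
  cases f w <;> cases v <;> simp

theorem HasQuorum.two_mul_lt {y : Event n ℓ Tx} (hy : y.HasQuorum) :
    2 * n < 3 * y.electors.card := by
  classical
  exact hy.trans_le (Nat.mul_le_mul_left _ Finset.card_image_le)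

theorem HasQuorum.tally_of_forall {f : Event n ℓ Tx → Bool} {y : Event n ℓ Tx} {v : Bool}
    (hy : y.HasQuorum) (h : ∀ w ∈ y.electors, f w = v) : 2 * n < 3 * tally f y v := by
  unfold tally
  rw [Finset.filter_true_of_mem h]
  exact hy.two_mul_lt

theorem HasQuorum.majority_of_forall {f : Event n ℓ Tx → Bool} {y : Event n ℓ Tx} {v : Bool}
    (hy : y.HasQuorum) (h : ∀ w ∈ y.electors, f w = v) : majority f y = v := by
  refine majority_eq_of_tally_lt ?_
  have h1 := hy.tally_of_forall h
  have h2 : tally f y (!v) = 0 := by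
    unfold tally
    rw [Finset.card_eq_zero, Finset.filter_eq_empty_iff]
    intro w hw
    rw [h w hw]
    cases v <;> simp
  omega

end Event

/-! ### How agreeing coins force a decision. -/

section Election

variable {n ℓ : ℕ} {Tx : Type*} {C : Finset (Fin n)} {S : Script n ℓ Tx} {A B y : Event n ℓ Tx}
  {f : Event n ℓ Tx → Bool} {v : Bool}

/-- Counting electors thus amounts to counting parties. -/
theorem Held.injOn_creator (hC : 3 * C.card < n) (hy : Held C S y) :
    Set.InjOn creator (y.electors : Set (Event n ℓ Tx)) :=
  fun _ hw _ hw' h => hy.electors_eq hC hy rfl (Finset.mem_coe.1 hw) (Finset.mem_coe.1 hw') h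

open Classical in
theorem Held.tally_eq (hC : 3 * C.card < n) (hy : Held C S y) (f : Event n ℓ Tx → Bool)
    (v : Bool) : tally f y v = ((y.electors.filter fun z => f z = v).image creator).card := by
  rw [tally, Finset.card_image_of_injOn]
  exact (hy.injOn_creator hC).mono (Finset.coe_subset.2 (Finset.filter_subset _ _))

/-- If a supermajority votes `v`, then `v` is the majority vote for all witnesses of this round. -/
theorem Held.majority_eq (hC : 3 * C.card < n) (hA : Held C S A) (hB : Held C S B)
    (hr : A.round = B.round) (hq : A.HasQuorum) (h : 2 * n < 3 * tally f B v) :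
    majority f A = v := by
  classical
  refine majority_eq_of_tally_lt ?_
  have h1 := tally_add_tally f A v
  have h2 := hq.two_mul_lt
  -- The two groups of voters have disjoint creators, since a common creator would have cast one and
  -- the same vote. Fewer than n/3 electors of `A` are left for `!v`.
  have h3 : tally f A (!v) + tally f B v ≤ n := by
    rw [hA.tally_eq hC, hB.tally_eq hC, ← Finset.card_union_of_disjoint]
    · simpa using Finset.card_le_univ (α := Fin n) _
    · rw [Finset.disjoint_left]
      intro i hi hi'
      obtain ⟨w, hw, rfl⟩ := Finset.mem_image.1 hi
      obtain ⟨w', hw', hc⟩ := Finset.mem_image.1 hi'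
      obtain ⟨hw, hf⟩ := Finset.mem_filter.1 hw
      obtain ⟨hw', hf'⟩ := Finset.mem_filter.1 hw'
      rw [hB.electors_eq hC hA hr.symm hw' hw hc, hf] at hf'
      cases v <;> simp at hf'
  omega

/-- If all honest electors vote `v`, then `v` is the majority vote. -/
theorem Held.majority_of_honest (hC : 3 * C.card < n) (hy : Held C S y) (hq : y.HasQuorum)
    (h : ∀ w ∈ y.electors, w.creator ∉ C → f w = v) : majority f y = v := by
  classical
  refine majority_eq_of_tally_lt ?_
  have h1 := tally_add_tally f y v
  have h2 := hq.two_mul_lt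
  have h3 : tally f y (!v) ≤ C.card := by
    rw [hy.tally_eq hC]
    refine Finset.card_le_card fun i hi => ?_
    obtain ⟨w, hw, rfl⟩ := Finset.mem_image.1 hi
    obtain ⟨hw, hf⟩ := Finset.mem_filter.1 hw
    by_contra hwC
    rw [h w hw hwC] at hf
    cases v <;> simp at hf
  omega

/-- `y` is a round-`ρ` witness that an honest party has created. -/
def HonestWitness (C : Finset (Fin n)) (S : Script n ℓ Tx) (ρ : ℕ) (y : Event n ℓ Tx) : Prop :=
  Held C S y ∧ y.creator ∉ C ∧ y.IsWitness ∧ y.round = ρ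

/-- All coins of honest round-`ρ` witnesses agree with the majority vote for one of them. -/
def CoinsAgree (C : Finset (Fin n)) (S : Script n ℓ Tx) (f : Event n ℓ Tx → Bool) (ρ : ℕ) :
    Prop :=
  ∀ B₀, HonestWitness C S ρ B₀ → ∃ A, HonestWitness C S ρ A ∧
    ∀ B, HonestWitness C S ρ B → middleBit B.data.signature = majority f A

/-- An election with infinitely many coin rounds in which the honest coins agree is decided. -/
theorem EventualDelivery.exists_electionDecides (hS : EventualDelivery C S) (hn : 2 ≤ n)
    (hC : 3 * C.card < n) {c : ℕ} (hc : 1 < c) (f : Event n ℓ Tx → Bool) (r : ℕ)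
    (h : ∀ m₀, ∃ m ≥ m₀, CoinsAgree C S (electionVote c f (m * c - 1)) (r + m * c))
    {j : Fin n} (hj : j ∉ C) :
    ∃ k, ∃ y ∈ hashgraphAt C S j k, ∃ v, ElectionDecides c f r y v := by
  obtain ⟨R, hR⟩ := hS.exists_round_hasQuorum hC
  -- As `m ≤ m * c`, this coin round lies beyond `R`, where all witnesses have quorums; also `m ≥
  -- 1`.
  obtain ⟨m, hm, hagree⟩ := h (R + 1)
  obtain ⟨d, hd⟩ : ∃ d, d = m * c := ⟨_, rfl⟩
  have hdc : d % c = 0 := by rw [hd]; exact Nat.mul_mod_left m c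
  have hmd : m ≤ d := hd ▸ Nat.le_mul_of_pos_right m (by omega)
  have hd2 : 2 ≤ d := by
    have := Nat.mul_le_mul (show 1 ≤ m by omega) hc
    omega
  rw [← hd] at hagree
  have hd1c : (d + 1) % c ≠ 0 := by
    rw [Nat.add_mod, hdc, Nat.zero_add, Nat.mod_mod, Nat.mod_eq_of_lt hc]
    omega
  obtain ⟨k, hk⟩ := hS.exists_le_round hn hC (r + d + 3)
  have hwit : ∀ s ≤ 3, ∃ y ∈ hashgraphAt C S j k, y.IsWitness ∧ y.round = r + d + s := by
    intro s hs
    obtain ⟨w, hw, h⟩ := exists_isWitness_round_eq (x := latestAt C S j k) (r := r + d + s)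
      (by omega) (by omega) (le_trans (by omega) (hk j hj))
    exact ⟨w, mem_hashgraphAt.2 hw, h⟩
  have hheld : ∀ {y w : Event n ℓ Tx}, Held C S y → w ∈ y.electors →
      Held C S w ∧ w.IsWitness ∧ w.round + 1 = y.round := fun hy hw =>
    have h := mem_electors.1 hw
    ⟨hy.of_mem_ancestors h.1, h.2.1, h.2.2.1⟩
  obtain ⟨y₁, hy₁, hy₁w, hy₁r⟩ := hwit 1 (by omega)
  have hy₁ : Held C S y₁ := ⟨j, hj, k, hy₁⟩
  obtain ⟨B₀, hB₀, hB₀C⟩ := (hR y₁ hy₁ (by omega)).exists_mem_electors hC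
  obtain ⟨hB₀h, hB₀w, hB₀r⟩ := hheld hy₁ hB₀
  obtain ⟨A, ⟨hA, -, -, hAr⟩, hcoin⟩ := hagree B₀ ⟨hB₀h, hB₀C, hB₀w, by omega⟩
  obtain ⟨v, hv⟩ : ∃ v, v = majority (electionVote c f (d - 1)) A := ⟨_, rfl⟩
  -- An honest witness either votes with its coin, equal to `v` by agreement, or has a
  -- supermajority, whose value is then the majority at `A` too.
  have vote0 : ∀ B, HonestWitness C S (r + d) B → electionVote c f d B = v := by
    intro B hB
    rw [electionVote_of_two_le hd2]
    split_ifs with hif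
    · rw [hv, hcoin B hB]
    · rw [hv, hA.majority_eq hC hB.1 (hAr.trans hB.2.2.2.symm) (hR A hA (by omega))]
      by_contra hlt
      exact hif ⟨hdc, hlt⟩
  -- This round is normal because `c > 1`, and the honest electors outvote the corrupted ones.
  have vote1 : ∀ B, Held C S B → B.IsWitness → B.round = r + d + 1 →
      electionVote c f (d + 1) B = v := by
    intro B hB hBw hBr
    rw [electionVote_of_two_le (by omega), if_neg fun h => hd1c h.1, Nat.add_sub_cancel]
    refine hB.majority_of_honest hC (hR B hB (by omega)) fun w hw hwC => ?_
    obtain ⟨h1, h2, h3⟩ := hheld hB hw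
    exact vote0 w ⟨h1, hwC, h2, by omega⟩
  have elect2 : ∀ B, Held C S B → B.round = r + d + 2 → ∀ w ∈ B.electors,
      electionVote c f (d + 1) w = v := by
    intro B hB hBr w hw
    obtain ⟨h1, h2, h3⟩ := hheld hB hw
    exact vote1 w h1 h2 (by omega)
  have vote2 : ∀ B, Held C S B → B.IsWitness → B.round = r + d + 2 →
      electionVote c f (d + 2) B = v := by
    intro B hB hBw hBr
    have hq := hR B hB (by omega)
    have he := elect2 B hB hBr
    rw [electionVote_of_two_le (by omega), show d + 2 - 1 = d + 1 by omega,
      hq.majority_of_forall he, if_neg fun h => h.2 (hq.tally_of_forall he)]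
  -- For `c = 2` the next round is again a coin round, where no decision is allowed. Unanimity then
  -- carries `v` one round further.
  by_cases hd2c : (d + 2) % c = 0
  · obtain ⟨y, hy, hyw, hyr⟩ := hwit 3 le_rfl
    have hyh : Held C S y := ⟨j, hj, k, hy⟩
    have hq := hR y hyh (by omega)
    have he : ∀ w ∈ y.electors, electionVote c f (d + 2) w = v := fun w hw => by
      obtain ⟨h1, h2, h3⟩ := hheld hyh hw
      exact vote2 w h1 h2 (by omega)
    refine ⟨k, y, hy, v, hyw, by omega, ?_, ?_⟩
    · rw [hyr, show r + d + 3 - r = d + 2 + 1 by omega, Nat.add_mod, hd2c, Nat.zero_add,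
        Nat.mod_mod, Nat.mod_eq_of_lt hc]
      omega
    · rw [hyr, show r + d + 3 - r - 1 = d + 2 by omega]
      exact ⟨(hq.majority_of_forall he).symm, hq.tally_of_forall he⟩
  · obtain ⟨y, hy, hyw, hyr⟩ := hwit 2 (by omega)
    have hyh : Held C S y := ⟨j, hj, k, hy⟩
    have hq := hR y hyh (by omega)
    have he := elect2 y hyh hyr
    refine ⟨k, y, hy, v, hyw, by omega, ?_, ?_⟩
    · rwa [hyr, show r + d + 2 - r = d + 2 by omega]
    · rw [hyr, show r + d + 2 - r - 1 = d + 1 by omega]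
      exact ⟨(hq.majority_of_forall he).symm, hq.tally_of_forall he⟩

/-- If the elections on all witnesses are decided, and so are the elections in which all first
votes are "no", then the fame of all witnesses up to a given round, including those that are
received later, is decided from some time on. -/
theorem exists_forall_allDecidedUpTo {c : ℕ} {j : Fin n}
    (h : ∀ x, x.IsWitness → ∀ k, x ∈ hashgraphAt C S j k →
      ∃ k', FameDecided c (hashgraphAt C S j k') x)
    (h₀ : ∀ r, ∃ k, ∃ y ∈ hashgraphAt C S j k, ∃ v, ElectionDecides c (fun _ => false) r y v)
    (r : ℕ) : ∃ K, ∀ k ≥ K, AllDecidedUpTo c (hashgraphAt C S j k) r := by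
  classical
  choose k₀ y₀ hy₀ v₀ hv₀ using h₀
  have h' : ∀ x, ∃ k', ∀ k, x ∈ hashgraphAt C S j k → x.IsWitness →
      FameDecided c (hashgraphAt C S j k') x := fun x => by
    by_cases hx : ∃ k, x ∈ hashgraphAt C S j k ∧ x.IsWitness
    · obtain ⟨k, hk, hw⟩ := hx
      obtain ⟨k', hk'⟩ := h x hw k hk
      exact ⟨k', fun _ _ _ => hk'⟩
    · exact ⟨0, fun k hk hw => absurd ⟨k, hk, hw⟩ hx⟩
  choose k₁ hk₁ using h'
  -- By time `T` the deciders of the all-"no" elections of rounds up to `r` are held. Only the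
  -- finitely many witnesses present at `T` need deciders of their own.
  let T := (Finset.range (r + 1)).sup k₀
  refine ⟨max T ((hashgraphAt C S j T).sup k₁), fun k hk x hx hxw hxr => ?_⟩
  by_cases hxT : x ∈ hashgraphAt C S j T
  · obtain ⟨y, hy, hxy⟩ := hk₁ x T hxT hxw
    exact ⟨y, hashgraphAt_mono j (((Finset.le_sup hxT).trans (le_max_right _ _)).trans hk) hy, hxy⟩
  · have hT : y₀ x.round ∈ hashgraphAt C S j T := hashgraphAt_mono j
      (Finset.le_sup (f := k₀) (Finset.mem_range.2 (by omega))) (hy₀ x.round)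
    refine ⟨y₀ x.round, hashgraphAt_mono j ((le_max_left _ _).trans hk) hT, v₀ x.round,
      decides_iff.2 ((hv₀ x.round).congr fun w hw => ?_)⟩
    refine (decide_eq_false fun hs : w.Sees x => hxT ?_).symm
    exact mem_hashgraphAt.2 (mem_ancestors_trans hs.1
      (mem_ancestors_trans hw (mem_hashgraphAt.1 hT)))

end Election

/-! ### Bets on coin rounds and bounds for losing them. -/

section Bets

variable {n ℓ : ℕ} {Tx : Type*} {C : Finset (Fin n)} {S : Script n ℓ Tx}

open Classical in
/-- The event, if any, that is created in a step. -/
noncomputable def created (C : Finset (Fin n)) (s : State n ℓ Tx) (σ : Signature ℓ) :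
    Step n ℓ Tx → Option (Event n ℓ Tx)
  | .deliver i y t =>
    if i ∉ C ∧ y ∉ s.hashgraph i ∧ Acceptable C s y then
      some (.node i (s.latest i) y ⟨s.buffer i, t, σ⟩)
    else none
  | _ => none

/-- The creator and parents of the new event are fixed before `σ`, so the two outcomes of the coin
can be compared. -/
theorem created_cases (C : Finset (Fin n)) (s : State n ℓ Tx) (st : Step n ℓ Tx) :
    (∀ σ, created C s σ st = none ∧
      (nextState C s σ st).latest = s.latest ∧ (nextState C s σ st).hashgraph = s.hashgraph) ∨
    ∃ i ∉ C, ∃ y, ∃ d : Signature ℓ → EventData ℓ Tx, (∀ σ, (d σ).signature = σ) ∧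
      Acceptable C s y ∧ ∀ σ, created C s σ st = some (.node i (s.latest i) y (d σ)) ∧
        (nextState C s σ st).latest =
          Function.update s.latest i (.node i (s.latest i) y (d σ)) ∧
        ∀ e, e ∈ (nextState C s σ st).hashgraph i ↔
          e = .node i (s.latest i) y (d σ) ∨ e ∈ s.hashgraph i ∨ e ∈ y.ancestors := by
  classical
  cases st with
  | idle => exact .inl fun σ => ⟨rfl, rfl, rfl⟩
  | submit i tx => exact .inl fun σ => ⟨rfl, rfl, rfl⟩
  | deliver i y t =>
    by_cases h : i ∉ C ∧ y ∉ s.hashgraph i ∧ Acceptable C s y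
    · refine .inr ⟨i, h.1, y, fun σ => ⟨s.buffer i, t, σ⟩, fun _ => rfl, h.2.2, fun σ => ?_⟩
      simp [created, nextState, h]
    · refine .inl fun σ => ?_
      simp only [created, nextState, if_neg h, and_self]

open Classical in
/-- One step of the bet that all coins of honest round-`ρ` witnesses agree with the value of `g`
for the first of these witnesses. The state of the bet consists of this value, if there is one yet,
and whether the bet still stands. -/
noncomputable def betStep (C : Finset (Fin n)) (ρ : ℕ) (g : Event n ℓ Tx → Bool)
    (s : State n ℓ Tx) (σ : Signature ℓ) (st : Step n ℓ Tx) (τ : Option Bool × Bool) :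
    Option Bool × Bool :=
  match created C s σ st with
  | none => τ
  | some z =>
    if z.IsWitness ∧ z.round = ρ then
      (some (τ.1.getD (g z)), τ.2 && (middleBit z.data.signature == τ.1.getD (g z)))
    else τ

/-- The state after `k` steps of the bet on round `ρ`. -/
noncomputable def bet (C : Finset (Fin n)) (S : Script n ℓ Tx) (ρ : ℕ)
    (g : Event n ℓ Tx → Bool) : ℕ → Option Bool × Bool
  | 0 => (none, true)
  | k + 1 => betStep C ρ g (run C S k) (S.signature k) (S.step k) (bet C S ρ g k)

variable {ρ : ℕ} {g : Event n ℓ Tx → Bool}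

theorem betStep_snd_of_eq_false {s : State n ℓ Tx} {σ : Signature ℓ} {st : Step n ℓ Tx}
    {τ : Option Bool × Bool} (h : τ.2 = false) : (betStep C ρ g s σ st τ).2 = false := by
  unfold betStep
  split
  · exact h
  · split_ifs <;> simp [h]

theorem bet_snd_eq_false_mono {k k' : ℕ} (hk : k ≤ k') (h : (bet C S ρ g k).2 = false) :
    (bet C S ρ g k').2 = false := by
  induction k', hk using Nat.le_induction with
  | base => exact h
  | succ m _ ih => exact betStep_snd_of_eq_false ih

/-- The meaning of a bet that stands after `k` steps. -/
theorem bet_spec (hρ : 2 ≤ ρ) (k : ℕ) (h : (bet C S ρ g k).2 = true) :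
    ((bet C S ρ g k).1 = none → ∀ i ∉ C, ∀ B ∈ hashgraphAt C S i k, B.creator = i →
      B.IsWitness → B.round ≠ ρ) ∧
    ∀ b, (bet C S ρ g k).1 = some b → (∃ A, HonestWitness C S ρ A ∧ b = g A) ∧
      ∀ i ∉ C, ∀ B ∈ hashgraphAt C S i k, B.creator = i → B.IsWitness → B.round = ρ →
        middleBit B.data.signature = b := by
  induction k with
  | zero =>
    -- Genesis events are witnesses that no step creates; `2 ≤ ρ` keeps them out of the bet.
    refine ⟨fun _ i _ B hB _ _ hr => ?_, fun b hb => by simp [bet] at hb⟩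
    simp only [hashgraphAt, run, initialState, Finset.mem_singleton] at hB
    rw [hB, round_genesis] at hr
    omega
  | succ k ih =>
    have hk : (bet C S ρ g k).2 = true := by
      by_contra hne
      rw [bet_snd_eq_false_mono (Nat.le_succ k) (Bool.not_eq_true _ ▸ hne)] at h
      exact absurd h (by simp)
    obtain ⟨ih1, ih2⟩ := ih hk
    have hbet : bet C S ρ g (k + 1) =
      betStep C ρ g (run C S k) (S.signature k) (S.step k) (bet C S ρ g k) := rfl
    rcases created_cases C (run C S k) (S.step k) with hcr | ⟨i, hi, y, d, hd, hacc, hcr⟩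
    · obtain ⟨h1, -, h2⟩ := hcr (S.signature k)
      have hH : ∀ j, hashgraphAt C S j (k + 1) = hashgraphAt C S j k := fun j => congrFun h2 j
      simp only [betStep, h1] at hbet
      simp only [hbet, hH]
      exact ⟨ih1, ih2⟩
    · obtain ⟨h1, hL, h2⟩ := hcr (S.signature k)
      simp only [betStep, h1] at hbet
      have hzd : (node i ((run C S k).latest i) y (d (S.signature k))).data.signature =
        S.signature k := hd _
      have hheld : Held C S (node i ((run C S k).latest i) y (d (S.signature k))) :=
        ⟨i, hi, k + 1, (h2 _).2 (.inl rfl)⟩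
      have hzi : (node i ((run C S k).latest i) y (d (S.signature k))).creator = i := rfl
      -- By unforgeability, the received ancestry contains no unknown event of an honest party in
      -- its own hashgraph.
      have hH : ∀ j ∉ C, ∀ B ∈ hashgraphAt C S j (k + 1), B.creator = j →
          B ∈ hashgraphAt C S j k ∨
            B = node i ((run C S k).latest i) y (d (S.signature k)) := by
        intro j hj B hB hBj
        rcases eq_or_ne j i with rfl | hji
        · rcases (h2 B).1 hB with h | h | h
          · exact .inr h
          · exact .inl h
          · have := (hacc B h).2 (by rwa [hBj])
            rw [hBj] at this
            exact .inl this
        · have : latestAt C S j (k + 1) = latestAt C S j k := by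
            change (nextState C (run C S k) _ _).latest j = _
            rw [hL, Function.update_of_ne hji]
          rw [mem_hashgraphAt, this, ← mem_hashgraphAt] at hB
          exact .inl hB
      generalize node i ((run C S k).latest i) y (d (S.signature k)) = z at *
      by_cases hz : z.IsWitness ∧ z.round = ρ
      · rw [if_pos hz] at hbet
        rw [hbet] at h ⊢
        simp only [hk, Bool.true_and, beq_iff_eq] at h
        refine ⟨fun h => by simp at h, fun b hb => ?_⟩
        simp only [Option.some.injEq] at hb
        rw [hb] at h
        have hzh : HonestWitness C S ρ z := ⟨hheld, by rwa [hzi], hz.1, hz.2⟩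
        cases hτ : (bet C S ρ g k).1 with
        | none =>
          rw [hτ, Option.getD_none] at hb
          refine ⟨⟨z, hzh, hb.symm⟩, fun j hj B hB hBj hBw hBr => ?_⟩
          rcases hH j hj B hB hBj with hB | rfl
          · exact absurd hBr (ih1 hτ j hj B hB hBj hBw)
          · exact h
        | some b' =>
          rw [hτ, Option.getD_some] at hb
          subst hb
          refine ⟨(ih2 b' hτ).1, fun j hj B hB hBj hBw hBr => ?_⟩
          rcases hH j hj B hB hBj with hB | rfl
          · exact (ih2 b' hτ).2 j hj B hB hBj hBw hBr
          · exact h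
      · rw [if_neg hz] at hbet
        rw [hbet]
        refine ⟨fun hτ j hj B hB hBj hBw hBr => ?_, fun b hτ => ⟨(ih2 b hτ).1,
          fun j hj B hB hBj hBw hBr => ?_⟩⟩
        · rcases hH j hj B hB hBj with hB | rfl
          · exact ih1 hτ j hj B hB hBj hBw hBr
          · exact hz ⟨hBw, hBr⟩
        · rcases hH j hj B hB hBj with hB | rfl
          · exact (ih2 b hτ).2 j hj B hB hBj hBw hBr
          · exact absurd ⟨hBw, hBr⟩ hz

theorem HonestWitness.exists_mem {B : Event n ℓ Tx} (hB : HonestWitness C S ρ B) :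
    ∃ k, B ∈ hashgraphAt C S B.creator k := by
  obtain ⟨k, hk⟩ := hB.1.exists_mem_selfAncestors hB.2.1
  exact ⟨k, mem_hashgraphAt.2 (selfAncestors_subset_ancestors _ (hk k le_rfl))⟩

/-- A bet that stands forever is won. -/
theorem coinsAgree_of_bet {f : Event n ℓ Tx → Bool} (hρ : 2 ≤ ρ)
    (h : ∀ k, (bet C S ρ (majority f) k).2 = true) : CoinsAgree C S f ρ := by
  intro B₀ hB₀
  obtain ⟨k₀, hk₀⟩ := hB₀.exists_mem
  obtain ⟨h1, h2⟩ := bet_spec hρ k₀ (h k₀)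
  cases hτ : (bet C S ρ (majority f) k₀).1 with
  | none => exact absurd hB₀.2.2.2 (h1 hτ _ hB₀.2.1 B₀ hk₀ rfl hB₀.2.2.1)
  | some b =>
    obtain ⟨⟨A, hA, rfl⟩, h3⟩ := h2 _ hτ
    refine ⟨A, hA, fun B hB => ?_⟩
    obtain ⟨k, hk⟩ := hB.exists_mem
    have hk := hashgraphAt_mono _ (le_max_right k₀ k) hk
    have hk₀' := hashgraphAt_mono _ (le_max_left k₀ k) hk₀
    obtain ⟨h1', h2'⟩ := bet_spec hρ (max k₀ k) (h _)
    cases hτ' : (bet C S ρ (majority f) (max k₀ k)).1 with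
    | none => exact absurd hB₀.2.2.2 (h1' hτ' _ hB₀.2.1 B₀ hk₀' rfl hB₀.2.2.1)
    | some b' =>
      have h3' := (h2' _ hτ').2
      -- The coin of `B₀` identifies the targets of the bet at the two times.
      rw [h3' _ hB.2.1 B hk rfl hB.2.2.1 hB.2.2.2,
        ← h3' _ hB₀.2.1 B₀ hk₀' rfl hB₀.2.2.1 hB₀.2.2.2]
      exact h3 _ hB₀.2.1 B₀ hk₀ rfl hB₀.2.2.1 hB₀.2.2.2

/-- The honest parties that have not reached round `ρ`. -/
noncomputable def behind (C : Finset (Fin n)) (ρ : ℕ) (s : State n ℓ Tx) : Finset (Fin n) :=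
  Finset.univ.filter fun i => i ∉ C ∧ (s.latest i).round < ρ

/-- An upper bound for the probability that a bet will be lost. -/
noncomputable def lossBound (C : Finset (Fin n)) (ρ : ℕ) (s : State n ℓ Tx)
    (τ : Option Bool × Bool) : ℝ :=
  -- A witness of round `ρ` takes its creator past the threshold, so each party behind has at most
  -- one coin left to toss in this bet.
  if τ.2 = true then 1 - (1 / 2) ^ (behind C ρ s).card else 1

theorem lossBound_nonneg (C : Finset (Fin n)) (ρ : ℕ) (s : State n ℓ Tx)
    (τ : Option Bool × Bool) : 0 ≤ lossBound C ρ s τ := by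
  unfold lossBound
  split_ifs
  · exact sub_nonneg.2 (pow_le_one₀ (by norm_num) (by norm_num))
  · exact zero_le_one

theorem lossBound_mono {s s' : State n ℓ Tx} (h : behind C ρ s' ⊆ behind C ρ s)
    (τ : Option Bool × Bool) : lossBound C ρ s' τ ≤ lossBound C ρ s τ := by
  unfold lossBound
  split_ifs
  · exact sub_le_sub_left (pow_le_pow_of_le_one (by norm_num) (by norm_num)
      (Finset.card_le_card h)) _
  · exact le_rfl

/-- In one step, at most one bet is at stake, and it is so on the toss of a fair coin. -/
theorem lossBound_step (C : Finset (Fin n)) (s : State n ℓ Tx) (st : Step n ℓ Tx)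
    {σ σ' : Signature ℓ} (hσ : middleBit σ ≠ middleBit σ') :
    ∃ r : ℕ, ∀ (ρ : ℕ) (g : Event n ℓ Tx → Bool),
      (∀ i p q d d', g (node i p q d) = g (node i p q d')) → ∀ τ,
      (ρ ≠ r → lossBound C ρ (nextState C s σ st) (betStep C ρ g s σ st τ) ≤ lossBound C ρ s τ ∧
        lossBound C ρ (nextState C s σ' st) (betStep C ρ g s σ' st τ) ≤ lossBound C ρ s τ) ∧
      lossBound C ρ (nextState C s σ st) (betStep C ρ g s σ st τ) +
        lossBound C ρ (nextState C s σ' st) (betStep C ρ g s σ' st τ) ≤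
          2 * lossBound C ρ s τ := by
  rcases created_cases C s st with hcr | ⟨i, hi, y, d, hd, hacc, hcr⟩
  · refine ⟨0, fun ρ g _ τ => ?_⟩
    have key : ∀ σ, lossBound C ρ (nextState C s σ st) (betStep C ρ g s σ st τ) =
        lossBound C ρ s τ := fun σ => by
      obtain ⟨h1, h2, -⟩ := hcr σ
      simp only [lossBound, betStep, h1, behind, h2]
    rw [key, key]
    exact ⟨fun _ => ⟨le_rfl, le_rfl⟩, by linarith⟩
  obtain ⟨z, hz⟩ : ∃ z : Signature ℓ → Event n ℓ Tx,
      z = fun σ => node i (s.latest i) y (d σ) := ⟨_, rfl⟩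
  have hzσ : ∀ σ, node i (s.latest i) y (d σ) = z σ := fun σ => by rw [hz]
  have hround : ∀ σ', (z σ').round = (z σ).round := fun σ' => by
    rw [hz]; exact round_node_congr _ _ _ _ _
  have hwit : ∀ σ', (z σ').IsWitness ↔ (z σ).IsWitness := fun σ' => by
    rw [hz]; exact isWitness_node_congr _ _ _ _ _
  have hle : (s.latest i).round ≤ (z σ).round := by
    rw [hz]; exact (le_max_left _ _).trans (max_round_le_round_node _ _ _ _)
  have hbehind : ∀ ρ σ, behind C ρ (nextState C s σ st) ⊆ behind C ρ s := by
    intro ρ σ' j hj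
    simp only [behind, Finset.mem_filter, Finset.mem_univ, true_and] at hj ⊢
    refine ⟨hj.1, ?_⟩
    have h2 := hj.2
    rw [(hcr σ').2.1, hzσ] at h2
    rcases eq_or_ne j i with rfl | hji
    · rw [Function.update_self, hround] at h2
      omega
    · rwa [Function.update_of_ne hji] at h2
  -- The round of the new event is independent of its signature and singles out the bet at stake.
  refine ⟨(z σ).round, fun ρ g hg τ => ?_⟩
  have hidle : ¬ ((z σ).IsWitness ∧ (z σ).round = ρ) → ∀ σ',
      lossBound C ρ (nextState C s σ' st) (betStep C ρ g s σ' st τ) ≤ lossBound C ρ s τ := by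
    intro hne σ'
    have h1 : betStep C ρ g s σ' st τ = τ := by
      simp only [betStep, (hcr σ').1]
      rw [hzσ, if_neg]
      rwa [hwit, hround]
    rw [h1]
    exact lossBound_mono (hbehind ρ σ') τ
  refine ⟨fun hρ => ⟨hidle (fun h => hρ h.2.symm) σ, hidle (fun h => hρ h.2.symm) σ'⟩, ?_⟩
  by_cases hw : (z σ).IsWitness ∧ (z σ).round = ρ
  swap
  · have h1 := hidle hw σ
    have h2 := hidle hw σ'
    linarith
  have hg' : ∀ σ', g (z σ') = g (z σ) := fun σ' => by rw [hz]; exact hg _ _ _ _ _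
  have hdata : ∀ σ', (z σ').data.signature = σ' := fun σ' => by rw [hz]; exact hd σ'
  have hbet : ∀ σ', betStep C ρ g s σ' st τ =
      (some (τ.1.getD (g (z σ))), τ.2 && (middleBit σ' == τ.1.getD (g (z σ)))) := by
    intro σ'
    simp only [betStep, (hcr σ').1]
    rw [hzσ, if_pos (by rwa [hwit, hround]), hg', hdata]
  by_cases hτ : τ.2 = true
  swap
  · rw [hbet, hbet]
    simp only [Bool.not_eq_true] at hτ
    simp only [lossBound, hτ, Bool.false_and]
    norm_num
  have hmem : i ∈ behind C ρ s := by
    simp only [behind, Finset.mem_filter, Finset.mem_univ, true_and]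
    refine ⟨hi, ?_⟩
    have := hw.1
    rw [hz] at this
    rw [← hw.2, hz]
    exact (isWitness_node _ _ _ _).1 this
  have hcard : ∀ σ', (behind C ρ (nextState C s σ' st)).card + 1 ≤ (behind C ρ s).card := by
    intro σ'
    refine Finset.card_lt_card (Finset.ssubset_iff_of_subset (hbehind ρ σ') |>.2 ⟨i, hmem, ?_⟩)
    simp only [behind, Finset.mem_filter, Finset.mem_univ, (hcr σ').2.1, hzσ,
      Function.update_self, hround, hw.2, lt_irrefl, and_false, not_false_iff]
  -- With p = 2^(-b) for the b parties behind, a won toss leaves at most 1 - 2p and a lost one gives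
  -- 1, so the mean is at most 1 - p.
  have hwon : ∀ σ', (1 : ℝ) - (1 / 2) ^ (behind C ρ (nextState C s σ' st)).card ≤
      1 - 2 * (1 / 2) ^ (behind C ρ s).card := by
    intro σ'
    have : ((1 : ℝ) / 2) ^ (behind C ρ s).card ≤
        (1 / 2) ^ ((behind C ρ (nextState C s σ' st)).card + 1) :=
      pow_le_pow_of_le_one (by norm_num) (by norm_num) (hcard σ')
    rw [pow_succ] at this
    linarith
  rw [hbet, hbet]
  simp only [lossBound, hτ, Bool.true_and, beq_iff_eq, if_true]
  have h1 := hwon σ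
  have h2 := hwon σ'
  generalize τ.1.getD (g (z σ)) = b
  by_cases hb : middleBit σ = b
  · rw [if_pos hb, if_neg (fun h => hσ (hb.trans h.symm))]
    linarith
  · rw [if_neg hb]
    split_ifs <;> first | linarith | skip
    rename_i h3
    exfalso
    revert hσ hb h3
    cases middleBit σ <;> cases middleBit σ' <;> cases b <;> simp

/-- The mean of a product is not the product of means. It is essential that all factors but one are
bounded by `w` in both outcomes. -/
theorem prod_add_prod_le {ι : Type*} [Fintype ι] {a b w : ι → ℝ} (ha : ∀ m, 0 ≤ a m)
    (hb : ∀ m, 0 ≤ b m) (m₀ : ι) (h : ∀ m ≠ m₀, a m ≤ w m ∧ b m ≤ w m)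
    (h₀ : a m₀ + b m₀ ≤ 2 * w m₀) : ∏ m, a m + ∏ m, b m ≤ 2 * ∏ m, w m := by
  classical
  rw [← Finset.mul_prod_erase _ a (Finset.mem_univ m₀),
    ← Finset.mul_prod_erase _ b (Finset.mem_univ m₀),
    ← Finset.mul_prod_erase _ w (Finset.mem_univ m₀)]
  have h1 : ∏ m ∈ Finset.univ.erase m₀, a m ≤ ∏ m ∈ Finset.univ.erase m₀, w m :=
    Finset.prod_le_prod (fun m _ => ha m) fun m hm => (h m (Finset.ne_of_mem_erase hm)).1
  have h2 : ∏ m ∈ Finset.univ.erase m₀, b m ≤ ∏ m ∈ Finset.univ.erase m₀, w m :=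
    Finset.prod_le_prod (fun m _ => hb m) fun m hm => (h m (Finset.ne_of_mem_erase hm)).2
  have h3 : 0 ≤ ∏ m ∈ Finset.univ.erase m₀, a m := Finset.prod_nonneg fun m _ => ha m
  have h4 := mul_le_mul_of_nonneg_left h1 (ha m₀)
  have h5 := mul_le_mul_of_nonneg_left h2 (hb m₀)
  have h6 := mul_le_mul_of_nonneg_right h₀ (h3.trans h1)
  linarith

/-- The product of the bounds does not increase in the mean over a coin toss. -/
theorem prod_lossBound_step {ι : Type*} [Fintype ι] (C : Finset (Fin n)) {ρ : ι → ℕ}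
    (hρ : Function.Injective ρ) {g : ι → Event n ℓ Tx → Bool}
    (hg : ∀ m i p q d d', g m (node i p q d) = g m (node i p q d')) (s : State n ℓ Tx)
    (st : Step n ℓ Tx) (τ : ι → Option Bool × Bool) {σ σ' : Signature ℓ}
    (hσ : middleBit σ ≠ middleBit σ') :
    ∏ m, lossBound C (ρ m) (nextState C s σ st) (betStep C (ρ m) (g m) s σ st (τ m)) +
      ∏ m, lossBound C (ρ m) (nextState C s σ' st) (betStep C (ρ m) (g m) s σ' st (τ m)) ≤
        2 * ∏ m, lossBound C (ρ m) s (τ m) := by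
  obtain ⟨r, hr⟩ := lossBound_step C s st hσ
  by_cases h : ∃ m, ρ m = r
  · obtain ⟨m₀, rfl⟩ := h
    exact prod_add_prod_le (fun _ => lossBound_nonneg _ _ _ _) (fun _ => lossBound_nonneg _ _ _ _)
      m₀ (fun m hm => (hr (ρ m) (g m) (hg m) (τ m)).1 fun h => hm (hρ h))
      (hr (ρ m₀) (g m₀) (hg m₀) (τ m₀)).2
  · push Not at h
    have h1 := Finset.prod_le_prod (s := Finset.univ)
      (fun m _ => lossBound_nonneg C (ρ m) _ _) fun m _ =>
        ((hr (ρ m) (g m) (hg m) (τ m)).1 (h m)).1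
    have h2 := Finset.prod_le_prod (s := Finset.univ)
      (fun m _ => lossBound_nonneg C (ρ m) _ _) fun m _ =>
        ((hr (ρ m) (g m) (hg m) (τ m)).1 (h m)).2
    linarith

end Bets

/-! ### Countability of events and states. -/

section Countable

variable {n ℓ : ℕ} {Tx : Type*}

/-- A numbering of events, given one of their contents. -/
def Event.code (e : EventData ℓ Tx → ℕ) : Event n ℓ Tx → ℕ
  | .genesis i d => Nat.pair 0 (Nat.pair i (e d))
  | .node i p q d => Nat.pair 1 (Nat.pair i (Nat.pair (e d) (Nat.pair (code e p) (code e q))))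

theorem Event.code_injective {e : EventData ℓ Tx → ℕ} (he : Function.Injective e) :
    Function.Injective (Event.code (n := n) e) := by
  intro x
  induction x with
  | genesis i d =>
    intro y h
    cases y with
    | genesis i' d' =>
      simp only [code, Nat.pair_eq_pair, true_and] at h
      rw [Fin.ext h.1, he h.2]
    | node i' p' q' d' => simp [code, Nat.pair_eq_pair] at h
  | node i p q d ihp ihq =>
    intro y h
    cases y with
    | genesis i' d' => simp [code, Nat.pair_eq_pair] at h
    | node i' p' q' d' =>
      simp only [code, Nat.pair_eq_pair, true_and] at h
      rw [Fin.ext h.1, he h.2.1, ihp h.2.2.1, ihq h.2.2.2]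

variable [Countable Tx]

instance : Countable (EventData ℓ Tx) :=
  Function.Injective.countable (f := fun d : EventData ℓ Tx =>
    (d.transactions, d.timestamp, d.signature)) fun a b h => by
      cases a; cases b; simpa using h

instance : Countable (Event n ℓ Tx) := by
  obtain ⟨e, he⟩ := exists_injective_nat (EventData ℓ Tx)
  exact (Event.code_injective he).countable

instance : Countable (Step n ℓ Tx) :=
  Function.Injective.countable (f := fun st : Step n ℓ Tx => match st with
    | .idle => (none : Option ((Fin n × Tx) ⊕ (Fin n × Event n ℓ Tx × ℕ)))
    | .submit i tx => some (.inl (i, tx))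
    | .deliver i y t => some (.inr (i, y, t))) fun a b h => by
      cases a <;> cases b <;> simp at h ⊢ <;> exact h

instance : Countable (State n ℓ Tx) :=
  Function.Injective.countable (f := fun s : State n ℓ Tx =>
    (s.hashgraph, s.latest, s.buffer)) fun a b h => by
      cases a; cases b; simpa using h

end Countable

/-! ### Supermartingale estimate and almost sure conclusions. -/

section Probability

/-- Any set of pairs is a countable union of points. Discrete σ-algebras therefore suffice
throughout, and every function of the state is measurable. -/
theorem measurable_top_prodMk {Ω α β : Type*} [Countable α] [Countable β] {m : MeasurableSpace Ω}
    {f : Ω → α} {g : Ω → β} (hf : Measurable[m, ⊤] f) (hg : Measurable[m, ⊤] g) :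
    Measurable[m, ⊤] fun ω => (f ω, g ω) := by
  intro s _
  have : (fun ω => (f ω, g ω)) ⁻¹' s = ⋃ a ∈ s, f ⁻¹' {a.1} ∩ g ⁻¹' {a.2} := by
    ext ω
    simp only [Set.mem_preimage, Set.mem_iUnion, Set.mem_inter_iff, Set.mem_singleton_iff,
      exists_prop]
    constructor
    · exact fun h => ⟨_, h, rfl, rfl⟩
    · rintro ⟨a, ha, h1, h2⟩
      rwa [h1, h2]
  rw [this]
  exact MeasurableSet.biUnion (Set.to_countable s) fun a _ =>
    (hf (MeasurableSpace.measurableSet_top)).inter (hg (MeasurableSpace.measurableSet_top))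

theorem measurable_top_comp {Ω α β : Type*} {m : MeasurableSpace Ω} {mβ : MeasurableSpace β}
    {f : Ω → α} (hf : Measurable[m, ⊤] f) (F : α → β) : Measurable[m, mβ] fun ω => F (f ω) :=
  fun s _ => hf (t := F ⁻¹' s) MeasurableSpace.measurableSet_top

/-- A quantity that depends on the past and on an independent fair coin does not exceed, in the
mean, any bound for its mean over the coin. -/
theorem lintegral_coin_le {Ω : Type*} {m mΩ : MeasurableSpace Ω} (hm : m ≤ mΩ) {P : Measure Ω}
    [IsProbabilityMeasure P] {X : Ω → Bool} (hX : Measurable X)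
    (hfair : P {ω | X ω = true} = 1 / 2) (hind : Indep (MeasurableSpace.comap X ⊤) m P)
    {W : Bool → Ω → ℝ≥0∞} (hW : ∀ b, Measurable[m] (W b)) {Φ : Ω → ℝ≥0∞}
    (h : ∀ ω, W true ω + W false ω ≤ 2 * Φ ω) :
    ∫⁻ ω, W (X ω) ω ∂P ≤ ∫⁻ ω, Φ ω ∂P := by
  have hms : ∀ b, MeasurableSet {ω | X ω = b} := fun b => hX (measurableSet_singleton b)
  have hfair' : ∀ b, P {ω | X ω = b} = 1 / 2 := by
    intro b
    cases b
    · have : {ω | X ω = false} = {ω | X ω = true}ᶜ := by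
        ext ω; simp
      rw [this, measure_compl (hms true) (measure_ne_top _ _), measure_univ, hfair]
      simp
    · exact hfair
  have key : ∀ b, ∫⁻ ω, W b ω * {ω | X ω = b}.indicator (fun _ => 1) ω ∂P =
      (∫⁻ ω, W b ω ∂P) * (1 / 2) := by
    intro b
    rw [lintegral_mul_indicator_eq_lintegral_mul_lintegral_indicator hm 1 (hms b) _ (hW b),
      lintegral_indicator_const (hms b), hfair' b, one_mul]
    rw [IndepSets_iff]
    intro s t hs ht
    rw [Set.mem_singleton_iff.1 ht, Set.inter_comm, mul_comm]
    exact (Indep_iff _ _ _).1 hind _ _ ⟨{b}, MeasurableSpace.measurableSet_top, rfl⟩ hs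
  have hmeas : ∀ b, Measurable (W b) := fun b => (hW b).mono hm le_rfl
  have hsum : ∀ ω, W (X ω) ω = W true ω * {ω | X ω = true}.indicator (fun _ => 1) ω +
      W false ω * {ω | X ω = false}.indicator (fun _ => 1) ω := by
    intro ω
    cases hω : X ω <;> simp [Set.indicator, hω]
  calc ∫⁻ ω, W (X ω) ω ∂P = (∫⁻ ω, W true ω ∂P) * (1 / 2) + (∫⁻ ω, W false ω ∂P) * (1 / 2) := by
        simp_rw [hsum]
        rw [lintegral_add_left, key, key]
        exact (hmeas true).mul (measurable_const.indicator (hms true))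
    _ = (∫⁻ ω, (W true ω + W false ω) ∂P) * (1 / 2) := by
        rw [lintegral_add_left (hmeas true), add_mul]
    _ ≤ (∫⁻ ω, 2 * Φ ω ∂P) * (1 / 2) := by
        gcongr with ω
        exact h ω
    _ = ∫⁻ ω, Φ ω ∂P := by
        rw [lintegral_const_mul' _ _ (by simp), mul_comm, ← mul_assoc, one_div,
          ENNReal.inv_mul_cancel (by simp) (by simp), one_mul]

variable {n ℓ : ℕ} {Tx : Type*} [Countable Tx] {C : Finset (Fin n)} {Ω : Type*}
  [mΩ : MeasurableSpace Ω] {P : Measure Ω} {𝓕 : Filtration ℕ mΩ}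
  {S : Ω → Script n ℓ Tx} {ι : Type*} [Fintype ι] {ρ : ι → ℕ} {g : ι → Event n ℓ Tx → Bool}

theorem IsRandomExecution.measurable_bet (hS : IsRandomExecution C P 𝓕 S) (ρ : ι → ℕ)
    (g : ι → Event n ℓ Tx → Bool) (k : ℕ) :
    Measurable[𝓕 k, ⊤] fun ω => (run C (S ω) k, fun m => bet C (S ω) (ρ m) (g m) k) := by
  induction k with
  | zero =>
    exact measurable_top_comp (measurable_top_prodMk hS.genesisClock hS.genesisSignature)
      -- The initial state ignores the steps and later signatures, so dummies serve.
      fun a => ((initialState ⟨a.1, a.2, fun _ => .idle, fun _ _ => false⟩ : State n ℓ Tx),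
        fun _ : ι => ((none : Option Bool), true))
  | succ k ih =>
    have h1 := ih.mono (𝓕.mono (Nat.le_succ k)) le_rfl
    have h2 := (hS.step k).mono (𝓕.mono (Nat.le_succ k)) le_rfl
    exact measurable_top_comp (measurable_top_prodMk h1 (measurable_top_prodMk h2 (hS.signature k)))
      fun a => (nextState C a.1.1 a.2.2 a.2.1,
        fun m => betStep C (ρ m) (g m) a.1.1 a.2.2 a.2.1 (a.1.2 m))

variable [IsProbabilityMeasure P]

/-- The product is a supermartingale, and at the start each factor is at most 1 - 2^(-n), since at
most `n` parties are behind. -/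
theorem IsRandomExecution.lintegral_lossBound_le (hS : IsRandomExecution C P 𝓕 S)
    (hρ : Function.Injective ρ)
    (hg : ∀ m i p q d d', g m (node i p q d) = g m (node i p q d')) (k : ℕ) :
    ∫⁻ ω, ENNReal.ofReal (∏ m, lossBound C (ρ m) (run C (S ω) k) (bet C (S ω) (ρ m) (g m) k)) ∂P ≤
      ENNReal.ofReal (1 - (1 / 2) ^ n) ^ Fintype.card ι := by
  have hprod : ∀ (s : State n ℓ Tx) (τ : ι → Option Bool × Bool), 0 ≤ ∏ m, lossBound C (ρ m) s (τ m) := fun s τ =>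
    Finset.prod_nonneg fun m _ => lossBound_nonneg C _ _ _
  induction k with
  | zero =>
    have h0 : (0 : ℝ) ≤ 1 - (1 / 2) ^ n :=
      sub_nonneg.2 (pow_le_one₀ (by norm_num) (by norm_num))
    have hle : ∀ ω, ∏ m, lossBound C (ρ m) (run C (S ω) 0) (bet C (S ω) (ρ m) (g m) 0) ≤
        (1 - (1 / 2) ^ n) ^ Fintype.card ι := fun ω => by
      rw [← Finset.card_univ, ← Finset.prod_const]
      refine Finset.prod_le_prod (fun m _ => lossBound_nonneg _ _ _ _) fun m _ => ?_
      simp only [lossBound, bet, if_true]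
      refine sub_le_sub_left (pow_le_pow_of_le_one (by norm_num) (by norm_num) ?_) _
      simpa using Finset.card_le_univ (behind C (ρ m) (run C (S ω) 0))
    rw [← ENNReal.ofReal_pow h0]
    refine (lintegral_mono fun ω => ENNReal.ofReal_le_ofReal (hle ω)).trans ?_
    rw [lintegral_const, measure_univ, mul_one]
  | succ k ih =>
    refine le_trans ?_ ih
    -- Only the middle bit is known to be independent of the past; the supremum allows for any
    -- behavior of the other bits of the signature.
    let W : Bool → (State n ℓ Tx × (ι → Option Bool × Bool)) × Step n ℓ Tx → ℝ≥0∞ := fun b a =>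
      ⨆ σ : Signature ℓ, ⨆ _ : middleBit σ = b,
        ENNReal.ofReal (∏ m, lossBound C (ρ m) (nextState C a.1.1 σ a.2)
          (betStep C (ρ m) (g m) a.1.1 σ a.2 (a.1.2 m)))
    let A : Ω → (State n ℓ Tx × (ι → Option Bool × Bool)) × Step n ℓ Tx := fun ω =>
      ((run C (S ω) k, fun m => bet C (S ω) (ρ m) (g m) k), (S ω).step k)
    have hX : Measurable fun ω => middleBit ((S ω).signature k) :=
      (measurable_top_comp (hS.signature k) middleBit).mono (𝓕.le _) le_rfl
    refine le_trans (lintegral_mono fun ω => ?_)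
      (lintegral_coin_le (𝓕.le k) hX (hS.coin_fair k) (hS.coin_indep k)
        (W := fun b ω => W b (A ω)) (fun b => ?_) fun ω => ?_)
    · exact le_iSup₂_of_le ((S ω).signature k) rfl le_rfl
    · exact measurable_top_comp (measurable_top_prodMk (hS.measurable_bet ρ g k) (hS.step k)) (W b)
    · refine ENNReal.biSup_add_biSup_le' (p := fun σ : Signature ℓ => middleBit σ = true)
        (q := fun σ : Signature ℓ => middleBit σ = false) ⟨fun _ => true, rfl⟩ ⟨fun _ => false, rfl⟩
        fun σ hσ σ' hσ' => ?_
      rw [← ENNReal.ofReal_add (hprod _ _) (hprod _ _), ← ENNReal.ofReal_ofNat,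
        ← ENNReal.ofReal_mul (by norm_num)]
      exact ENNReal.ofReal_le_ofReal (prod_lossBound_step C hρ hg _ _ _ (by rw [hσ, hσ']; simp))

/-- The probability that all of several bets are lost is exponentially small. -/
theorem IsRandomExecution.measure_forall_bet_le (hS : IsRandomExecution C P 𝓕 S)
    (hρ : Function.Injective ρ)
    (hg : ∀ m i p q d d', g m (node i p q d) = g m (node i p q d')) (k : ℕ) :
    P {ω | ∀ m, (bet C (S ω) (ρ m) (g m) k).2 = false} ≤
      ENNReal.ofReal (1 - (1 / 2) ^ n) ^ Fintype.card ι := by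
  refine le_trans ?_ (hS.lintegral_lossBound_le hρ hg k)
  have hmeas : Measurable fun ω => ENNReal.ofReal
      (∏ m, lossBound C (ρ m) (run C (S ω) k) (bet C (S ω) (ρ m) (g m) k)) :=
    Measurable.mono (measurable_top_comp (hS.measurable_bet ρ g k) fun a =>
      ENNReal.ofReal (∏ m, lossBound C (ρ m) a.1 (a.2 m))) (𝓕.le k) le_rfl
  -- Markov's inequality at threshold 1: every lost bet contributes a factor 1.
  refine le_trans ?_ (mul_meas_ge_le_lintegral hmeas 1)
  rw [one_mul]
  refine measure_mono fun ω hω => ?_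
  simp only [Set.mem_ofPred_eq] at hω ⊢
  simp [lossBound, hω]

/-- Almost surely, infinitely many bets are won. -/
theorem IsRandomExecution.ae_exists_forall_bet (hS : IsRandomExecution C P 𝓕 S) {ρ : ℕ → ℕ}
    {g : ℕ → Event n ℓ Tx → Bool} (hρ : Function.Injective ρ)
    (hg : ∀ m i p q d d', g m (node i p q d) = g m (node i p q d')) :
    ∀ᵐ ω ∂P, ∀ m₀, ∃ m ≥ m₀, ∀ k, (bet C (S ω) (ρ m) (g m) k).2 = true := by
  rw [ae_all_iff]
  intro m₀
  rw [ae_iff]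
  have hlt : ENNReal.ofReal (1 - (1 / 2) ^ n) < 1 := by
    rw [ENNReal.ofReal_lt_one]
    have : (0 : ℝ) < (1 / 2) ^ n := by positivity
    linarith
  refine le_antisymm (ge_of_tendsto' (ENNReal.tendsto_pow_atTop_nhds_zero_of_lt_one hlt)
    fun M => ?_) zero_le
  let B : ℕ → Set Ω := fun k =>
    {ω | ∀ m : Fin M, (bet C (S ω) (ρ (m₀ + m)) (g (m₀ + m)) k).2 = false}
  have hB : Monotone B := fun k k' hk ω hω m => bet_snd_eq_false_mono hk (hω m)
  -- A lost bet stays lost, so finitely many bets that are lost at various times are all lost at a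
  -- common time.
  have hsub : {ω | ¬ ∃ m ≥ m₀, ∀ k, (bet C (S ω) (ρ m) (g m) k).2 = true} ⊆ ⋃ k, B k := by
    intro ω hω
    simp only [Set.mem_ofPred_eq, not_exists, not_and, not_forall, Bool.not_eq_true] at hω
    choose f hf using fun m : Fin M => hω (m₀ + m) (Nat.le_add_right _ _)
    exact Set.mem_iUnion.2 ⟨Finset.univ.sup f, fun m =>
      bet_snd_eq_false_mono (Finset.le_sup (Finset.mem_univ m)) (hf m)⟩
  refine (measure_mono hsub).trans ?_
  rw [hB.measure_iUnion]
  refine iSup_le fun k => ?_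
  have := hS.measure_forall_bet_le (ρ := fun m : Fin M => ρ (m₀ + m))
    (g := fun m : Fin M => g (m₀ + m))
    (fun a b h => Fin.ext (Nat.add_left_cancel (hρ h))) (fun m => hg _) k
  rwa [Fintype.card_fin] at this

/-- Almost surely, every election is decided by all honest parties. -/
theorem IsRandomExecution.ae_exists_electionDecides (hS : IsRandomExecution C P 𝓕 S) (hn : 2 ≤ n)
    (hC : 3 * C.card < n) {c : ℕ} (hc : 1 < c) (f : Event n ℓ Tx → Bool) (r : ℕ) :
    ∀ᵐ ω ∂P, ∀ j ∉ C, ∃ k, ∃ y ∈ hashgraphAt C (S ω) j k, ∃ v, ElectionDecides c f r y v := by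
  have hbet := hS.ae_exists_forall_bet (ρ := fun m => r + m * c)
    (g := fun m => majority (electionVote c f (m * c - 1)))
    (fun a b h => Nat.eq_of_mul_eq_mul_right (by omega) (Nat.add_left_cancel h))
    (fun m i p q d d' => majority_node_congr _ i p q d d')
  filter_upwards [hbet, hS.delivery] with ω hω hdel j hj
  refine hdel.exists_electionDecides hn hC hc f r (fun m₀ => ?_) hj
  -- The `+ 2` gives `2 ≤ r + m * c`, as `coinsAgree_of_bet` requires.
  obtain ⟨m, hm, h⟩ := hω (m₀ + 2)
  have : m * 1 ≤ m * c := Nat.mul_le_mul_left m hc.le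
  exact ⟨m, by omega, coinsAgree_of_bet (by omega) h⟩

/-- Almost surely, the fame of every event, as far as it is a witness, is decided. -/
theorem IsRandomExecution.ae_fameDecided (hS : IsRandomExecution C P 𝓕 S) (hn : 2 ≤ n)
    (hC : 3 * C.card < n) {c : ℕ} (hc : 1 < c) :
    ∀ᵐ ω ∂P, ∀ x, ∀ j ∉ C, ∃ k, FameDecided c (hashgraphAt C (S ω) j k) x := by
  -- Events are countable, so one null set serves them all, whatever the adversary creates.
  rw [ae_all_iff]
  intro x
  filter_upwards [hS.ae_exists_electionDecides hn hC hc (firstVote x) x.round] with ω hω j hj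
  obtain ⟨k, y, hy, v, h⟩ := hω j hj
  exact ⟨k, y, hy, v, decides_iff.2 h⟩

/-- Almost surely, for every round, the fame of all witnesses up to this round is decided from some
time on. -/
theorem IsRandomExecution.ae_allDecidedUpTo (hS : IsRandomExecution C P 𝓕 S) (hn : 2 ≤ n)
    (hC : 3 * C.card < n) {c : ℕ} (hc : 1 < c) :
    ∀ᵐ ω ∂P, ∀ j ∉ C, ∀ r, ∃ K, ∀ k ≥ K, AllDecidedUpTo c (hashgraphAt C (S ω) j k) r := by
  have h0 := ae_all_iff.2 fun r =>
    hS.ae_exists_electionDecides hn hC hc (fun _ => false) r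
  filter_upwards [hS.ae_fameDecided hn hC hc, h0] with ω hω hω0 j hj r
  exact exists_forall_allDecidedUpTo (fun x _ _ _ => hω x j hj) (fun r => hω0 r j hj) r

/-- Almost surely, every honest event `x` is seen by all events of some round `r`, and, from some
time on, every honest party has reached round `r` and decided the fame of all witnesses of rounds up
to `r`. -/
theorem IsRandomExecution.ae_exists_round (hS : IsRandomExecution C P 𝓕 S) (hn : 2 ≤ n)
    (hC : 3 * C.card < n) {c : ℕ} (hc : 1 < c) :
    ∀ᵐ ω ∂P, ∀ x, Held C (S ω) x → x.creator ∉ C → ∃ r ≥ 1,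
      (∀ w, Held C (S ω) w → w.round = r → w.Sees x) ∧
      ∀ j ∉ C, ∃ K, ∀ k ≥ K, x ∈ hashgraphAt C (S ω) j k ∧
        (∃ w ∈ hashgraphAt C (S ω) j k, w.IsWitness ∧ w.round = r) ∧
        AllDecidedUpTo c (hashgraphAt C (S ω) j k) r := by
  filter_upwards [hS.ae_allDecidedUpTo hn hC hc, hS.delivery] with ω hω hdel x hx hxC
  obtain ⟨r, hr, hsees⟩ := hdel.exists_round_sees hC hx hxC
  refine ⟨r, hr, fun w hw hwr => hsees w hw hwr.ge, fun j hj => ?_⟩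
  obtain ⟨K₁, hK₁⟩ := hω j hj r
  obtain ⟨K₂, hK₂⟩ := hdel.exists_le_round hn hC r
  obtain ⟨K₃, -, hK₃⟩ := hdel.exists_forall_mem hx 0
  obtain ⟨w, hw, h⟩ := exists_isWitness_round_eq (by omega) hr (hK₂ j hj)
  refine ⟨max K₁ (max K₂ K₃), fun k hk => ⟨hashgraphAt_mono j (by omega) (hK₃ j hj),
    ⟨w, hashgraphAt_mono j ?_ (mem_hashgraphAt.2 hw), h⟩, hK₁ k (by omega)⟩⟩
  omega

/-- Almost surely, every honest event is output to the logs of all honest parties. -/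
theorem IsRandomExecution.ae_mem_eventLog (hS : IsRandomExecution C P 𝓕 S) (hn : 2 ≤ n)
    (hC : 3 * C.card < n) {c : ℕ} (hc : 1 < c) :
    ∀ᵐ ω ∂P, ∀ x, Held C (S ω) x → x.creator ∉ C →
      ∀ j ∉ C, ∃ k, x ∈ eventLog c C (S ω) j k := by
  classical
  filter_upwards [hS.ae_exists_round hn hC hc] with ω hω x hx hxC j hj
  obtain ⟨r, hr, hsees, h⟩ := hω x hx hxC
  obtain ⟨K, hK⟩ := h j hj
  obtain ⟨h1, -, h2⟩ := hK K le_rfl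
  have hex : ∃ r, 1 ≤ r ∧ AllDecidedUpTo c (hashgraphAt C (S ω) j K) r ∧
      ∀ w, IsUniqueFamousWitness c (hashgraphAt C (S ω) j K) r w → w.Sees x :=
    ⟨r, hr, h2, fun w hw => hsees w ⟨j, hj, K, hw.1.1⟩ hw.2.1⟩
  exact ⟨K, K, le_rfl, Nat.find hex, h1, Nat.find_spec hex, fun r' hr' => Nat.find_min' hex hr'⟩

/-- A version of the first claim with a bound on the number of rounds, for the first `k` steps. -/
theorem IsRandomExecution.tendsto_measure_decided (hS : IsRandomExecution C P 𝓕 S) (hn : 2 ≤ n)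
    (hC : 3 * C.card < n) {c : ℕ} (hc : 1 < c) {i : Fin n} (hi : i ∉ C) (k : ℕ) :
    Tendsto (fun m : ℕ => P {ω | ∀ x ∈ hashgraphAt C (S ω) i k, x.IsWitness →
        ∃ k', ∃ y ∈ hashgraphAt C (S ω) i k', y.round ≤ x.round + m * c ∧ ∃ v, Decides c x y v})
      atTop (𝓝 1) := by
  let D : ℕ → Set Ω := fun m => {ω | ∀ x ∈ hashgraphAt C (S ω) i k, x.IsWitness →
    ∃ k', ∃ y ∈ hashgraphAt C (S ω) i k', y.round ≤ x.round + m * c ∧ ∃ v, Decides c x y v}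
  have hD : Monotone D := fun m m' hm ω hω x hx hxw => by
    obtain ⟨k', y, hy, hr, h⟩ := hω x hx hxw
    exact ⟨k', y, hy, hr.trans (Nat.add_le_add_left (Nat.mul_le_mul_right c hm) _), h⟩
  have hae : ∀ᵐ ω ∂P, ω ∈ ⋃ m, D m := by
    filter_upwards [hS.ae_fameDecided hn hC hc] with ω hω
    choose f y hy v hv using fun x => hω x i hi
    -- The hashgraph at time `k` is finite; the largest round of the chosen deciders serves as `m`,
    -- because `m ≤ m * c`.
    refine Set.mem_iUnion.2 ⟨(hashgraphAt C (S ω) i k).sup fun x => (y x).round, fun x hx _ =>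
      ⟨f x, y x, hy x, ?_, v x, hv x⟩⟩
    have h1 := Finset.le_sup (f := fun x => (y x).round) hx
    exact (h1.trans (Nat.le_mul_of_pos_right _ (by omega))).trans (Nat.le_add_left _ _)
  have := tendsto_measure_iUnion_atTop (μ := P) hD
  have h1 : P (⋃ m, D m) = 1 :=
    (measure_congr (s := ⋃ m, D m) (eventuallyEq_univ.2 hae)).trans measure_univ
  rwa [h1] at this

end Probability

end Hashgraph

open Hashgraph Hashgraph.Event in
theorem theorem8 {n t c ℓ : ℕ} {Tx : Type*} [Countable Tx] (hn : 2 ≤ n) (ht : 3 * t < n)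
    (hc : 1 < c) (C : Finset (Fin n)) (hC : C.card ≤ t)
    {Ω : Type*} [mΩ : MeasurableSpace Ω] (P : Measure Ω) [IsProbabilityMeasure P]
    (𝓕 : Filtration ℕ mΩ) (S : Ω → Script n ℓ Tx) (hS : IsRandomExecution C P 𝓕 S) :
    -- almost surely, the fame of every witness that an honest party holds is eventually decided
    (∀ᵐ ω ∂P, ∀ i ∉ C, ∀ k, ∀ x ∈ hashgraphAt C (S ω) i k, x.IsWitness →
      ∃ k' ≥ k, FameDecided c (hashgraphAt C (S ω) i k') x) ∧
    -- the probability of a decision within `m` coin rounds tends to `1`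
    (∀ i ∉ C, ∀ k, Tendsto
      (fun m : ℕ => P {ω | ∀ x ∈ hashgraphAt C (S ω) i k, x.IsWitness →
        ∃ k', ∃ y ∈ hashgraphAt C (S ω) i k', y.round ≤ x.round + m * c ∧ ∃ v, Decides c x y v})
      atTop (𝓝 1)) ∧
    -- almost surely, for every honest event there is a round, reached and fully decided by every
    -- honest party, all of whose unique famous witnesses see the event
    (∀ᵐ ω ∂P, ∀ i ∉ C, ∀ k, ∀ x ∈ hashgraphAt C (S ω) i k, x.creator ∉ C →
      ∃ r ≥ 1, ∀ j ∉ C,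
        (∃ k', (∃ w ∈ hashgraphAt C (S ω) j k', w.IsWitness ∧ w.round = r) ∧
          AllDecidedUpTo c (hashgraphAt C (S ω) j k') r) ∧
        ∀ k' w, IsUniqueFamousWitness c (hashgraphAt C (S ω) j k') r w → w.Sees x) ∧
    -- almost surely, every honest event is eventually in the log of every honest party
    (∀ᵐ ω ∂P, ∀ i ∉ C, ∀ k, ∀ x ∈ hashgraphAt C (S ω) i k, x.creator ∉ C →
      ∀ j ∉ C, ∃ k', x ∈ eventLog c C (S ω) j k') ∧
    -- almost surely, every transaction placed in the buffer of an honest party is eventually in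
    -- the log of every honest party
    (∀ᵐ ω ∂P, ∀ i ∉ C, ∀ k tx, (S ω).step k = Step.submit i tx →
      ∀ j ∉ C, ∃ k', tx ∈ transactionLog c C (S ω) j k') := by
  have hC : 3 * C.card < n := by omega
  refine ⟨?_, fun i hi k => hS.tendsto_measure_decided hn hC hc hi k, ?_, ?_, ?_⟩
  · filter_upwards [hS.ae_fameDecided hn hC hc] with ω hω i hi k x _ _
    obtain ⟨k', y, hy, h⟩ := hω x i hi
    exact ⟨max k k', le_max_left _ _, y, hashgraphAt_mono i (le_max_right _ _) hy, h⟩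
  · filter_upwards [hS.ae_exists_round hn hC hc] with ω hω i hi k x hx hxC
    obtain ⟨r, hr, hsees, h⟩ := hω x ⟨i, hi, k, hx⟩ hxC
    refine ⟨r, hr, fun j hj => ⟨?_, fun k' w hw => hsees w ⟨j, hj, k', hw.1.1⟩ hw.2.1⟩⟩
    obtain ⟨K, hK⟩ := h j hj
    exact ⟨K, (hK K le_rfl).2⟩
  · filter_upwards [hS.ae_mem_eventLog hn hC hc] with ω hω i hi k x hx hxC j hj
    exact hω x ⟨i, hi, k, hx⟩ hxC j hj
  · filter_upwards [hS.ae_mem_eventLog hn hC hc, hS.delivery] with ω hω hdel i hi k tx hk j hj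
    obtain ⟨k', x, hx, rfl, htx⟩ := hdel.exists_mem_transactions hn hC hi hk
    obtain ⟨k'', h⟩ := hω x ⟨x.creator, hi, k', hx⟩ hi j hj
    exact ⟨k'', x, h, htx⟩
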